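/- Conventions. An $n$-dimensional convex polytope $P$ is *simple* if exactly $n$ of its facets (nonempty codimension-one faces) meet at each vertex. $K(P)$ denotes the boundary complex of the simplicial polytope dual to $P$: the abstract simplicial complex whose vertices are the facets of $P$ and whose simplices are the sets of facets (including the empty set) having a common point in $P$. For a simplicial complex $K$ on a vertex set $V$ (with $\emptyset\in K$), the moment-angle complex is \[ Z_K=\bigcup_{\sigma\in K}\Big(\prod_{i\in\sigma}D^2\times\prod_{i\in V\setminus\sigma}S^1\Big)\subset\mathbb{C}^{V}, \] where $S^1\subset D^2\subset\mathbb{C}$ are the unit circle and the closed unit disc. Put $T^k=(S^1)^k$. A continuous action of $T^n$ on a space $M$ is *locally standard* if every point of $M$ has a $T^n$-invariant open neighbourhood $U$ with a homeomorphism $\varphi$ onto an open subset of $\mathbb{C}^n$ such that $\varphi(tx)=\theta(t)\varphi(x)$ for all $t\in T^n$, $x\in U$ and some automorphism $\theta$ of the topological group $T^n$, where $T^n$ acts on $\mathbb{C}^n$ coordinatewise. Then $M/T^n$ is locally modelled on $\mathbb{C}^n/T^n=(\mathbb{R}_{\ge 0})^n$. A *quasitoric manifold over* an $n$-dimensional simple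 polytope $P$ is a closed (i.e. compact, Hausdorff, without boundary) topological manifold $M$ of dimension $2n$ with a locally standard action of $T^n$ such that $M/T^n$ is isomorphic to $P$ as a manifold with corners, that is, there is a homeomorphism $M/T^n\to P$ under which an orbit whose points have exactly $k$ vanishing coordinates in the standard charts corresponds to a point lying in exactly $k$ facets of $P$. Finally, $\Omega X$ denotes the space of based loops in $X$ with the compact-open topology. **Proposition 2.4.** Let $M$ be a quasitoric manifold over an $n$-dimensional simple polytope $P$ with $m$ facets. Then, for any choice of base points in $M$ and in $Z_{K(P)}$, there is a homotopy equivalence \[ \Omega M\simeq T^{m-n}\times\Omega Z_{K(P)}. \] -/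

import Mathlib

open scoped ContinuousMap

noncomputable section

namespace Quasitoric

/-! ### Simple polytopes -/

section Polytope

variable {E : Type*} [NormedAddCommGroup E] [NormedSpace ℝ E]

/-- A convex polytope: the convex hull of a nonempty finite set of points. -/
def IsConvexPolytope (P : Set E) : Prop :=
  ∃ s : Set E, s.Finite ∧ s.Nonempty ∧ P = convexHull ℝ s

/-- The dimension of a convex set: the dimension of its affine span. -/
def dimension (P : Set E) : ℕ :=
  Module.finrank ℝ (vectorSpan ℝ P)

/-- A facet of `P`: a nonempty face of codimension one. (The nonempty faces of a polytope
are its nonempty exposed subsets: the subsets on which some linear functional attains its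
maximum over `P`.) -/
def IsFacet (P F : Set E) : Prop :=
  F.Nonempty ∧ IsExposed ℝ P F ∧ dimension F + 1 = dimension P

/-- The type of facets of `P`. -/
abbrev Facet (P : Set E) : Type _ :=
  {F : Set E // IsFacet P F}

/-- The number of facets of `P` containing the point `p`. For a point `p` of a simple polytope
this is the codimension of the face whose relative interior contains `p`, that is, the depth
of `p` in the manifold with corners `P`. -/
def facetDepth (P : Set E) (p : E) : ℕ :=
  {F : Set E | IsFacet P F ∧ p ∈ F}.ncard

/-- `P` is a simple convex polytope of dimension `n`: exactly `n` facets meet at each vertex. -/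
structure IsSimplePolytope (n : ℕ) (P : Set E) : Prop where
  isConvexPolytope : IsConvexPolytope P
  dimension_eq : dimension P = n
  facets_at_vertex : ∀ v ∈ P.extremePoints ℝ, facetDepth P v = n

/-- The simplicial complex `K(P)`, the boundary of the simplicial polytope dual to the simple
polytope `P`, as an abstract simplicial complex. Its vertices are the facets of `P`; faces of the
dual correspond to faces of `P` with inclusions reversed, so a set of facets is a simplex exactly
when these facets have a common point. The empty simplex is included. -/
def boundaryDual (P : Set E) : Set (Finset (Facet P)) :=
  {σ | (P ∩ ⋂ F ∈ σ, F.val).Nonempty}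

end Polytope

/-! ### Moment-angle complexes -/

/-- The moment-angle complex `Z_K = ⋃_{σ ∈ K} Z(σ)` inside `ℂ^ι`, where `Z(σ)` is the product
with factor `D²` (the closed unit disc) at `i ∈ σ` and factor `S¹` at `i ∉ σ`. -/
def momentAngleComplex {ι : Type*} (K : Set (Finset ι)) : Set (ι → ℂ) :=
  ⋃ σ ∈ K, {z | (∀ i ∈ σ, z i ∈ Metric.closedBall (0 : ℂ) 1) ∧
    ∀ i ∉ σ, z i ∈ Metric.sphere (0 : ℂ) 1}

/-! ### Quasitoric manifolds -/

/-- The torus `T^k = (S¹)^k`. -/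
abbrev Torus (k : ℕ) : Type :=
  Fin k → Circle

section Manifold

variable (n : ℕ) (M : Type*) [TopologicalSpace M] [MulAction (Torus n) M]

/-- A standard chart of a `T^n`-space `M`: a homeomorphism from a `T^n`-invariant open subset
of `M` onto an open subset of `ℂ^n` which is weakly equivariant, i.e. equivariant up to an
automorphism of `T^n`, for the coordinatewise action of `T^n` on `ℂ^n`. -/
structure StandardChart where
  /-- The underlying homeomorphism between open subsets. -/
  chart : OpenPartialHomeomorph M (Fin n → ℂ)
  /-- The automorphism of the torus. -/
  aut : Torus n ≃ₜ* Torus n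
  smul_mem_source : ∀ (t : Torus n), ∀ x ∈ chart.source, t • x ∈ chart.source
  chart_smul : ∀ (t : Torus n), ∀ x ∈ chart.source,
    chart (t • x) = fun i => (aut t i : ℂ) * chart x i

/-- The number of vanishing coordinates of a point of `ℂ^n`. As `ℂ^n / T^n = (ℝ_{≥0})^n` via the
absolute values of the coordinates, this is the depth of the orbit of `z` in the
manifold with corners `(ℝ_{≥0})^n`. -/
def coordDepth {n : ℕ} (z : Fin n → ℂ) : ℕ :=
  {i | z i = 0}.ncard

/-- The `T^n`-space `M` is a quasitoric manifold over the `n`-dimensional simple polytope `P`: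
a closed `2n`-dimensional (topological) manifold with a locally standard continuous `T^n`-action
whose orbit space is isomorphic to `P` as a manifold with corners, i.e. by a homeomorphism which
preserves depth. (The standard charts make `M` locally homeomorphic to `ℂ^n`, and
make `M / T^n` locally homeomorphic to `(ℝ_{≥0})^n`.) -/
structure IsQuasitoricManifold {E : Type*} [NormedAddCommGroup E] [NormedSpace ℝ E]
    (P : Set E) : Prop where
  compactSpace : CompactSpace M
  t2Space : T2Space M
  continuousSMul : ContinuousSMul (Torus n) M
  locallyStandard : ∀ x : M, ∃ c : StandardChart n M, x ∈ c.chart.source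
  orbitSpace : ∃ h : Quotient (MulAction.orbitRel (Torus n) M) ≃ₜ P,
    ∀ (x : M) (c : StandardChart n M), x ∈ c.chart.source →
      coordDepth (c.chart x) = facetDepth P (h (Quotient.mk _ x) : E)

end Manifold

end Quasitoric

end

/-! Let λ : T^m → T^n (`charHom`) send the circle of each facet `F` isomorphically onto the common
stabilizer of the points over the relative interior of `F`, and let `s` be a section of the orbit
map M → P. The moment-angle manifold Z_P consists of a point p of `P` together with, for each facet,
a complex number of modulus `slack F p`. The map `collapse`, (p, w) ↦ λ(w/|w|) • s(p), is well
defined and continuous because a coordinate without a phase belongs to a facet through p, whose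
circle fixes s(p). Stabilizers are generated by such circles, so the fibres are the orbits of ker λ
(`collapse_eq_iff`). At a vertex λ maps the torus of the n facets there isomorphically onto T^n;
hence ker λ is T^(m-n), and Z_P → M is a principal bundle (`isTrivialNear_collapse`).

For a principal bundle X → B with torus group K, lifting loops identifies ΩB, up to homotopy, with
the pairs of k ∈ K and a path from x₀ to k x₀. Up to homotopy equivalence this space depends only on
the homotopy class of k ↦ k x₀; if that map is null-homotopic, the space is K × ΩX
(`loopSpace_homotopyEquiv_prod`). Here Z_P ≃ Z_K by truncating slacks and interpolating
(`nonempty_homotopy_manifold`, `nonempty_homotopy_complex`). The orbit comes from the standard torus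
of Z_K, which contracts in Z_K because each coordinate circle bounds a disc: every single facet is a
simplex.

Homotopy lifting (`exists_homotopy_lift`) and the section (`OrbitMap.exists_section`) rest on one
device: local solutions differ by torus-valued functions, whose logarithms are averaged with a
partition of unity. -/

noncomputable section

namespace Quasitoric

open scoped unitInterval Topology
open Set Filter

/-! ### Families of paths -/

section Paths

variable {A X Y : Type*} [TopologicalSpace A] [TopologicalSpace X] [TopologicalSpace Y]

/-- The pairs of a parameter `a` and a path from `s a` to `e a`. -/
abbrev PathFamily (s e : A → X) : Type _ :=
  {p : A × C(I, X) // p.2 0 = s p.1 ∧ p.2 1 = e p.1}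

/-- The path `w` followed by the initial segment of length `v` of the path `g`. -/
def prolong (v : I) (w g : C(I, X)) (u : I) : X :=
  -- The concatenation has length `1 + v`. With this rescaling `v = 0` gives back `w` exactly, so
  -- `v` can serve as a homotopy parameter.
  if (u : ℝ) * (1 + v) ≤ 1 then w (projIcc 0 1 zero_le_one ((u : ℝ) * (1 + v)))
  else g (projIcc 0 1 zero_le_one ((u : ℝ) * (1 + v) - 1))

theorem continuous_prolong {v : Y → I} {w g : Y → C(I, X)} (hv : Continuous v)
    (hw : Continuous w) (hg : Continuous g) (h : ∀ y, w y 1 = g y 0) :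
    Continuous fun p : Y × I => prolong (v p.1) (w p.1) (g p.1) p.2 := by
  unfold prolong
  refine Continuous.if_le ?_ ?_ (by fun_prop) continuous_const ?_
  · exact ContinuousEval.continuous_eval.comp ((hw.comp continuous_fst).prodMk
      ((continuous_projIcc (h := zero_le_one)).comp (by fun_prop)))
  · exact ContinuousEval.continuous_eval.comp ((hg.comp continuous_fst).prodMk
      ((continuous_projIcc (h := zero_le_one)).comp (by fun_prop)))
  · rintro ⟨y, u⟩ hu
    simp only at hu ⊢
    rw [hu]
    simp [h]

theorem prolong_zero_right (v : I) (w g : C(I, X)) : prolong v w g 0 = w 0 := by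
  simp [prolong]

theorem prolong_one (v : I) (w g : C(I, X)) (h : w 1 = g 0) : prolong v w g 1 = g v := by
  unfold prolong
  split_ifs with hv
  · have : v = 0 := by
      exact Subtype.ext (le_antisymm (by simpa using hv) v.2.1)
    simp [this, h]
  · simp

theorem prolong_zero_left (w g : C(I, X)) (u : I) : prolong 0 w g u = w u := by
  have : (u : ℝ) ≤ 1 := u.2.2
  simp [prolong, this]

/-- `prolong` as a path. -/
def prolongPath (v : I) (w g : C(I, X)) (h : w 1 = g 0) : C(I, X) :=
  ⟨prolong v w g, (continuous_prolong (Y := Unit) (v := fun _ => v) (w := fun _ => w)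
    (g := fun _ => g) continuous_const continuous_const continuous_const fun _ => h).comp
      (Continuous.prodMk_right ())⟩

theorem continuous_prolongPath {v : Y → I} {w g : Y → C(I, X)} (hv : Continuous v)
    (hw : Continuous w) (hg : Continuous g) (h : ∀ y, w y 1 = g y 0) :
    Continuous fun y => prolongPath (v y) (w y) (g y) (h y) :=
  ContinuousMap.continuous_of_continuous_uncurry _ (continuous_prolong hv hw hg h)

/-- The track of a point under a homotopy. -/
def track {f g : C(A, X)} (G : f.Homotopy g) (a : A) : C(I, X) :=
  ⟨fun u => G (u, a), by fun_prop⟩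

theorem continuous_track {f g : C(A, X)} (G : f.Homotopy g) : Continuous (track G) :=
  ContinuousMap.continuous_of_continuous_uncurry _
    (G.continuous.comp (continuous_snd.prodMk continuous_fst))

/-- The initial segment of length `v` of the track of a point, run backwards. -/
def backTrack {f g : C(A, X)} (G : f.Homotopy g) (v : I) (a : A) : C(I, X) :=
  ⟨fun u => G (projIcc 0 1 zero_le_one ((v : ℝ) - u), a),
    G.continuous.comp ((continuous_projIcc.comp (by fun_prop)).prodMk continuous_const)⟩

theorem continuous_backTrack {f g : C(A, X)} (G : f.Homotopy g) :
    Continuous fun p : I × A => backTrack G p.1 p.2 :=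
  ContinuousMap.continuous_of_continuous_uncurry _
    (G.continuous.comp ((continuous_projIcc.comp (by fun_prop)).prodMk (by fun_prop)))

/-- Transport of paths along a homotopy of their end points. -/
def PathFamily.transport {s : A → X} {e e' : C(A, X)} (G : e.Homotopy e') :
    C(PathFamily s e, PathFamily s e') where
  toFun p := ⟨(p.1.1, prolongPath 1 p.1.2 (track G p.1.1) (by simp [track, p.2.2])), by
    refine ⟨?_, ?_⟩
    · simpa [prolongPath, prolong_zero_right] using p.2.1
    · simp only [prolongPath, ContinuousMap.coe_mk]
      rw [prolong_one _ _ _ (by simp [track, p.2.2])]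
      simp [track]⟩
  continuous_toFun := by
    refine Continuous.subtype_mk (Continuous.prodMk (by fun_prop) ?_) _
    exact continuous_prolongPath continuous_const (by fun_prop)
      ((continuous_track G).comp (by fun_prop)) _

/-- Follow the track for time `v` and run it back for time `v`: nothing is added at `v = 0`, and `v
= 1` is the composite. -/
theorem PathFamily.transport_symm_comp {s : A → X} {e e' : C(A, X)} (G : e.Homotopy e') :
    ((PathFamily.transport (s := s) G.symm).comp (PathFamily.transport G)).Homotopic
      (ContinuousMap.id _) := by
  have h1 : ∀ (p : I × PathFamily s e), p.2.1.2 1 = track G p.2.1.1 0 := by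
    intro p; simp [track, p.2.2.2]
  have h2 : ∀ (p : I × PathFamily s e),
      prolongPath p.1 p.2.1.2 (track G p.2.1.1) (h1 p) 1 = backTrack G p.1 p.2.1.1 0 := by
    intro p
    simp only [prolongPath, ContinuousMap.coe_mk]
    rw [prolong_one _ _ _ (h1 p)]
    simp [backTrack, track]
  refine ContinuousMap.Homotopic.symm ⟨⟨⟨fun p => ⟨(p.2.1.1, prolongPath p.1
    (prolongPath p.1 p.2.1.2 (track G p.2.1.1) (h1 p)) (backTrack G p.1 p.2.1.1) (h2 p)),
      ?_, ?_⟩, ?_⟩, ?_, ?_⟩⟩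
  · simpa [prolongPath, prolong_zero_right] using p.2.2.1
  · change prolong _ _ _ 1 = _
    rw [prolong_one _ _ _ (h2 p)]
    simp [backTrack]
  · refine Continuous.subtype_mk (Continuous.prodMk
      (continuous_fst.comp (continuous_subtype_val.comp continuous_snd)) ?_) _
    refine continuous_prolongPath continuous_fst ?_ ?_ h2
    · exact continuous_prolongPath (by fun_prop) (by fun_prop)
        ((continuous_track G).comp (by fun_prop)) h1
    · exact (continuous_backTrack G).comp (continuous_fst.prodMk
        (continuous_fst.comp (continuous_subtype_val.comp continuous_snd)))
  · rintro ⟨⟨a, w⟩, hw⟩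
    apply Subtype.ext
    refine Prod.ext rfl ?_
    ext u
    simp [prolongPath, prolong_zero_left]
  · rintro ⟨⟨a, w⟩, hw⟩
    apply Subtype.ext
    refine Prod.ext rfl ?_
    have : backTrack G 1 a = track G.symm a := by
      ext u
      simp only [backTrack, track, ContinuousMap.coe_mk, ContinuousMap.Homotopy.symm_apply]
      congr 2
      rw [projIcc_of_mem zero_le_one (x := (((1 : I) : ℝ) - u)) ⟨by simp [u.2.2], by simp [u.2.1]⟩]
      rfl
    simp only [this]
    rfl

/-- Families of paths with homotopic end points are homotopy equivalent. -/
theorem PathFamily.homotopyEquiv_of_end {s : A → X} {e e' : C(A, X)} (h : e.Homotopic e') :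
    Nonempty (PathFamily s e ≃ₕ PathFamily s e') := by
  obtain ⟨G⟩ := h
  refine ⟨⟨PathFamily.transport G, PathFamily.transport G.symm,
    PathFamily.transport_symm_comp G, ?_⟩⟩
  have := PathFamily.transport_symm_comp (s := s) G.symm
  rwa [ContinuousMap.Homotopy.symm_symm] at this

/-- Reversal of paths. -/
def PathFamily.reverse (s e : A → X) : PathFamily s e ≃ₜ PathFamily e s where
  toFun p := ⟨(p.1.1, p.1.2.comp ⟨σ, by fun_prop⟩), by simp [p.2.1, p.2.2]⟩
  invFun p := ⟨(p.1.1, p.1.2.comp ⟨σ, by fun_prop⟩), by simp [p.2.1, p.2.2]⟩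
  left_inv p := by
    apply Subtype.ext
    refine Prod.ext rfl ?_
    ext u; simp
  right_inv p := by
    apply Subtype.ext
    refine Prod.ext rfl ?_
    ext u; simp
  continuous_toFun := by
    refine Continuous.subtype_mk (Continuous.prodMk (by fun_prop) ?_) _
    exact (ContinuousMap.continuous_precomp _).comp (by fun_prop)
  continuous_invFun := by
    refine Continuous.subtype_mk (Continuous.prodMk (by fun_prop) ?_) _
    exact (ContinuousMap.continuous_precomp _).comp (by fun_prop)

/-- Families of paths with constant end points form a product. -/
def PathFamily.prodHomeo (A : Type*) [TopologicalSpace A] (x y : X) :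
    PathFamily (fun _ : A => x) (fun _ => y) ≃ₜ A × Path x y where
  toFun p := (p.1.1, ⟨p.1.2, p.2.1, p.2.2⟩)
  invFun p := ⟨(p.1, p.2.toContinuousMap), p.2.source, p.2.target⟩
  left_inv p := rfl
  right_inv p := rfl
  continuous_toFun := by
    refine Continuous.prodMk (by fun_prop) ?_
    exact continuous_induced_rng.2 (by
      change Continuous fun p : PathFamily (fun _ : A => x) (fun _ => y) => p.1.2
      fun_prop)
  continuous_invFun := by
    refine Continuous.subtype_mk (Continuous.prodMk (by fun_prop) ?_) _
    exact continuous_induced_dom.comp continuous_snd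

/-- The loop spaces at two points joined by a path are homotopy equivalent. -/
theorem loopSpace_homotopyEquiv_of_joined {x y : X} (h : Joined x y) :
    Nonempty (LoopSpace X x ≃ₕ LoopSpace X y) := by
  obtain ⟨γ⟩ := h
  have hG : (ContinuousMap.const Unit x).Homotopic (ContinuousMap.const Unit y) :=
    ⟨⟨⟨fun p => γ p.1, by fun_prop⟩, by simp, by simp⟩⟩
  obtain ⟨e₁⟩ := PathFamily.homotopyEquiv_of_end (s := fun _ : Unit => x) hG
  obtain ⟨e₂⟩ := PathFamily.homotopyEquiv_of_end (s := fun _ : Unit => y) hG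
  have E (z : X) : PathFamily (fun _ : Unit => z) (fun _ => z) ≃ₕ LoopSpace X z :=
    ((PathFamily.prodHomeo Unit z z).trans (Homeomorph.punitProd _)).toHomotopyEquiv
  -- Only final end points can be moved, so the path is reversed between the two moves.
  exact ⟨(E x).symm.trans ((e₁.trans ((PathFamily.reverse (fun _ : Unit => x) fun _ => y
    ).toHomotopyEquiv.trans e₂)).trans (E y))⟩

/-- A based homotopy equivalence induces a homotopy equivalence of loop spaces. -/
theorem loopSpace_homotopyEquiv_of_based {f : C(X, Y)} {g : C(Y, X)} {x : X}
    (H : (g.comp f).HomotopyRel (ContinuousMap.id X) {x})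
    (H' : (f.comp g).HomotopyRel (ContinuousMap.id Y) {f x}) :
    Nonempty (LoopSpace X x ≃ₕ LoopSpace Y (f x)) := by
  have hx : g (f x) = x := by
    have h1 := H.eq_fst 1 (mem_singleton x)
    simpa using h1.symm
  refine ⟨⟨⟨fun γ => γ.map f.continuous, ?_⟩,
    ⟨fun γ => (γ.map g.continuous).cast hx.symm hx.symm, ?_⟩,
    ⟨⟨⟨fun p => ⟨⟨fun u => H (p.1, p.2 u), by fun_prop⟩, ?_, ?_⟩, ?_⟩, ?_, ?_⟩⟩,
    ⟨⟨⟨fun p => ⟨⟨fun u => H' (p.1, p.2 u), by fun_prop⟩, ?_, ?_⟩, ?_⟩, ?_, ?_⟩⟩⟩⟩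
  · refine Path.continuous_uncurry_iff.mp ?_
    change Continuous fun p : Path x x × I => f (p.1 p.2)
    fun_prop
  · refine Path.continuous_uncurry_iff.mp ?_
    change Continuous fun p : Path (f x) (f x) × I => g (p.1 p.2)
    fun_prop
  · have := H.eq_fst p.1 (mem_singleton x)
    simp only [Path.source, this, ContinuousMap.comp_apply, hx]
  · have := H.eq_fst p.1 (mem_singleton x)
    simp only [Path.target, this, ContinuousMap.comp_apply, hx]
  · refine Path.continuous_uncurry_iff.mp ?_
    change Continuous fun p : (I × Path x x) × I => H (p.1.1, p.1.2 p.2)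
    fun_prop
  · intro γ
    ext u
    change H (0, γ u) = _
    simp
  · intro γ
    ext u
    change H (1, γ u) = _
    simp
  · have := H'.eq_fst p.1 (mem_singleton (f x))
    simp only [Path.source, this, ContinuousMap.comp_apply, hx]
  · have := H'.eq_fst p.1 (mem_singleton (f x))
    simp only [Path.target, this, ContinuousMap.comp_apply, hx]
  · refine Path.continuous_uncurry_iff.mp ?_
    change Continuous fun p : (I × Path (f x) (f x)) × I => H' (p.1.1, p.1.2 p.2)
    fun_prop
  · intro γ
    ext u
    change H' (0, γ u) = _
    simp
  · intro γ
    ext u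
    change H' (1, γ u) = _
    simp

end Paths

/-! ### Logarithms -/

section Log

variable {κ K Z : Type*} [CommGroup K] [TopologicalSpace K] [TopologicalSpace Z]

/-- The exponential map onto a torus. -/
def torusExp (e : K ≃ₜ* (κ → Circle)) (v : κ → ℝ) : K :=
  e.symm fun i => Circle.exp (v i)

theorem continuous_torusExp (e : K ≃ₜ* (κ → Circle)) : Continuous (torusExp e) :=
  e.symm.continuous.comp (by fun_prop)

theorem torusExp_add (e : K ≃ₜ* (κ → Circle)) (v w : κ → ℝ) :
    torusExp e (v + w) = torusExp e v * torusExp e w := by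
  rw [torusExp, torusExp, torusExp, ← map_mul]
  congr 1
  ext i
  simp [Circle.exp_add]

theorem torusExp_zero (e : K ≃ₜ* (κ → Circle)) : torusExp e 0 = 1 := by
  rw [torusExp, ← map_one e.symm]
  congr 1
  ext i
  simp

theorem torusExp_eq_iff (e : K ≃ₜ* (κ → Circle)) {v : κ → ℝ} {k : K} :
    torusExp e v = k ↔ ∀ i, Circle.exp (v i) = e k i := by
  rw [torusExp, ← funext_iff]
  exact ⟨fun h => by rw [← h]; exact (e.apply_symm_apply _).symm,
    fun h => by rw [h]; exact e.symm_apply_apply _⟩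

/-- Two real lifts of a map to a torus which agree at a point of a connected space agree. -/
theorem eq_of_torusExp_eq [PreconnectedSpace Z] (e : K ≃ₜ* (κ → Circle)) {v w : Z → κ → ℝ}
    (hv : Continuous v) (hw : Continuous w) (h : ∀ z, torusExp e (v z) = torusExp e (w z)) {z₀ : Z}
    (h0 : v z₀ = w z₀) : v = w := by
  have hi : ∀ i, (fun z => v z i) = fun z => w z i := by
    intro i
    refine Circle.isCoveringMap_exp.eq_of_comp_eq (by fun_prop) (by fun_prop) ?_ z₀
      (congrFun h0 i)
    funext z
    have := (torusExp_eq_iff e).1 (h z) i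
    rw [Function.comp_apply, this, ← (torusExp_eq_iff e).1 rfl i]
    rfl
  funext z i
  exact congrFun (hi i) z

end Log

/-! ### Principal torus bundles -/

section Principal

variable {κ K X B A Z : Type*} [CommGroup K] [TopologicalSpace K] [TopologicalSpace X]
  [MulAction K X] [TopologicalSpace B] [TopologicalSpace A] [TopologicalSpace Z]

variable (K) in
/-- Over an open neighbourhood of `b`, the `K`-space `q : X → B` admits an equivariant map
to `K`. -/
def IsTrivialNear (q : X → B) (b : B) : Prop :=
  ∃ U : Set B, IsOpen U ∧ b ∈ U ∧ ∃ φ : X → K, ContinuousOn φ (q ⁻¹' U) ∧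
    ∀ k : K, ∀ x ∈ q ⁻¹' U, φ (k • x) = k * φ x

theorem smul_injective_of_isTrivialNear {q : X → B} {x : X} (h : IsTrivialNear K q (q x))
    {k k' : K} (hk : k • x = k' • x) : k = k' := by
  obtain ⟨U, -, hx, φ, -, heq⟩ := h
  have := congrArg φ hk
  rw [heq k x hx, heq k' x hx] at this
  exact mul_right_cancel this

/-- The element of the structure group relating two points of a fibre depends continuously on
these points. -/
theorem continuous_of_smul_eq [IsTopologicalGroup K] {q : X → B} {x y : Z → X}
    (hx : Continuous x) (hy : Continuous y) (hqc : Continuous q) (hq : ∀ z, q (x z) = q (y z))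
    (htriv : ∀ z, IsTrivialNear K q (q (x z)))
    {k : Z → K} (hk : ∀ z, k z • x z = y z) : Continuous k := by
  rw [continuous_iff_continuousAt]
  intro z
  obtain ⟨U, hU, hz, φ, hφ, heq⟩ := htriv z
  have hN : ∀ᶠ w in 𝓝 z, q (x w) ∈ U :=
    (hqc.comp hx).continuousAt.eventually (hU.mem_nhds hz)
  have hV : q ⁻¹' U ∈ 𝓝 (x z) := (hU.preimage hqc).mem_nhds hz
  have hV' : q ⁻¹' U ∈ 𝓝 (y z) := (hU.preimage hqc).mem_nhds (by rwa [mem_preimage, ← hq])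
  -- Near `z` the group element is the quotient of the values of a trivialization.
  have h : ContinuousAt (fun w => φ (y w) * (φ (x w))⁻¹) z :=
    ((hφ.continuousAt hV').comp hy.continuousAt).mul
      ((hφ.continuousAt hV).comp hx.continuousAt).inv
  refine h.congr ?_
  filter_upwards [hN] with w hw
  rw [← hk w, heq _ _ hw, mul_inv_cancel_right]

/-- Families of paths in a torus starting at the identity have continuous logarithms. -/
theorem exists_log (e : K ≃ₜ* (κ → Circle)) {k : I × A → K} (hk : Continuous k)
    (h0 : ∀ a, k (0, a) = 1) : ∃ δ : I × A → κ → ℝ, Continuous δ ∧ (∀ a, δ (0, a) = 0) ∧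
      ∀ p, torusExp e (δ p) = k p := by
  have hc : ∀ i, Continuous fun p => e (k p) i :=
    fun i => (continuous_apply i).comp (e.continuous.comp hk)
  have h0' : ∀ i a, (⟨fun p => e (k p) i, hc i⟩ : C(I × A, Circle)) (0, a) =
      Circle.exp ((ContinuousMap.const A (0 : ℝ)) a) := by
    intro i a
    simp [h0]
  refine ⟨fun p i => Circle.isCoveringMap_exp.liftHomotopy _ _ (h0' i) p, by fun_prop, ?_, ?_⟩
  · intro a
    funext i
    exact Circle.isCoveringMap_exp.liftHomotopy_zero _ _ (h0' i) a
  · intro p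
    rw [torusExp_eq_iff]
    intro i
    exact congrFun (Circle.isCoveringMap_exp.liftHomotopy_lifts _ _ (h0' i)) p

variable [IsTopologicalGroup K] [ContinuousSMul K X]

/-- A local trivialization of a quotient map has a continuous local section. -/
theorem exists_section_of_trivialization {q : X → B} (hq : Topology.IsQuotientMap q)
    (hfib : ∀ x y, q x = q y ↔ ∃ k : K, k • x = y) {U : Set B} (hU : IsOpen U) {φ : X → K}
    (hφ : ContinuousOn φ (q ⁻¹' U)) (heq : ∀ k : K, ∀ x ∈ q ⁻¹' U, φ (k • x) = k * φ x) :
    ∃ s : B → X, ContinuousOn s U ∧ (∀ b ∈ U, q (s b) = b) ∧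
      ∀ x ∈ q ⁻¹' U, φ x • s (q x) = x := by
  obtain ⟨r, hr⟩ := hq.surjective.hasRightInverse
  -- The normalized point depends only on the fibre, so the set-theoretic inverse `r` may be
  -- discontinuous.
  have key : ∀ x ∈ q ⁻¹' U, (φ (r (q x)))⁻¹ • r (q x) = (φ x)⁻¹ • x := by
    intro x hx
    obtain ⟨k, hk⟩ := (hfib x (r (q x))).1 (hr (q x)).symm
    rw [← hk, heq k x hx, mul_inv, smul_smul, mul_right_comm, inv_mul_cancel, one_mul]
  refine ⟨fun b => (φ (r b))⁻¹ • r b, ?_, ?_, ?_⟩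
  · rw [continuousOn_iff_continuous_domRestrict, (hq.restrictPreimage_isOpen hU).continuous_iff]
    have : Continuous fun x : q ⁻¹' U => (φ x)⁻¹ • (x : X) :=
      (continuousOn_iff_continuous_domRestrict.1 hφ).inv.smul continuous_subtype_val
    refine this.congr fun x => (key x x.2).symm
  · intro b _
    have : q (r b) = q ((φ (r b))⁻¹ • r b) := (hfib _ _).2 ⟨_, rfl⟩
    rw [← this, hr]
  · intro x hx
    simp only
    rw [key x hx, smul_inv_smul]

/-- Local homotopy lifting. -/
theorem exists_local_lift {q : X → B} (hq : Topology.IsQuotientMap q)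
    (hfib : ∀ x y, q x = q y ↔ ∃ k : K, k • x = y) (H : C(I × A, B))
    (hH : ∀ p, IsTrivialNear K q (H p)) (f : C(A, X)) (hf : ∀ a, q (f a) = H (0, a)) (a : A) :
    ∃ N : Set A, IsOpen N ∧ a ∈ N ∧ ∃ F : I × A → X, ContinuousOn F (univ ×ˢ N) ∧
      (∀ p ∈ (univ : Set I) ×ˢ N, q (F p) = H p) ∧ ∀ b ∈ N, F (0, b) = f b := by
  choose U hU hmem φ hφ heq using hH
  choose s hs hqs hφs using fun p =>
    exists_section_of_trivialization hq hfib (hU p) (hφ p) (heq p)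
  -- Cut `I` into intervals on each of which `H (·, a)` stays in one trivializing set; the lift is
  -- extended interval by interval, over a shrinking neighbourhood of `a`.
  obtain ⟨t, t_0, t_mono, ⟨m, hm⟩, t_sub⟩ :=
    exists_monotone_Icc_subset_open_cover_unitInterval
      (c := fun u : I => (fun v : I => H (v, a)) ⁻¹' U (u, a))
      (fun u => (hU (u, a)).preimage (by fun_prop))
      fun v _ => mem_iUnion.mpr ⟨v, hmem _⟩
  suffices ∀ n, ∃ N : Set A, IsOpen N ∧ a ∈ N ∧ ∃ F : I × A → X,
      ContinuousOn F (Icc 0 (t n) ×ˢ N) ∧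
      (∀ p ∈ Icc 0 (t n) ×ˢ N, q (F p) = H p) ∧ ∀ b ∈ N, F (0, b) = f b by
    have hI : (Icc 0 (t m) : Set I) = univ := by
      rw [hm m le_rfl]
      exact eq_univ_of_forall fun u => ⟨u.2.1, u.2.2⟩
    simpa only [hI] using this m
  intro n
  induction n with
  | zero =>
    refine ⟨univ, isOpen_univ, mem_univ _, fun p => f p.2, by fun_prop, ?_, fun b _ => rfl⟩
    rintro ⟨u, b⟩ ⟨hu, -⟩
    rw [t_0, Icc_self, mem_singleton_iff] at hu
    simp only at hu ⊢
    rw [hf, hu]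
  | succ n ih =>
    obtain ⟨N, hN, haN, F, hF, hqF, hF0⟩ := ih
    obtain ⟨e, he⟩ := t_sub n
    obtain ⟨W, v, -, hv, hW, hav, hWv⟩ := generalized_tube_lemma
      (isClosed_Icc (a := t n) (b := t (n + 1))).isCompact (isCompact_singleton (x := a))
      ((hU (e, a)).preimage H.continuous) (by
        rintro ⟨u, b⟩ ⟨hu, hb⟩
        rw [mem_singleton_iff] at hb
        simp only at hb
        subst hb
        exact he hu)
    rw [singleton_subset_iff] at hav
    have hUv : ∀ u b, u ∈ Icc (t n) (t (n + 1)) → b ∈ v → H (u, b) ∈ U (e, a) :=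
      fun u b hu hb => hWv ⟨hW hu, hb⟩
    have hF' : ∀ b ∈ N, q (F (t n, b)) = H (t n, b) :=
      fun b hb => hqF _ ⟨⟨(t n).2.1, le_rfl⟩, hb⟩
    have htn : t n ∈ Icc (t n) (t (n + 1)) := ⟨le_rfl, t_mono n.le_succ⟩
    classical
    -- Beyond `t n` the local section is translated by a group element that depends on the parameter
    -- but not on time, chosen so that the two formulas agree at `t n`.
    refine ⟨N ∩ v, hN.inter hv, ⟨haN, hav⟩, fun p => if p.1 ≤ t n then F p else
      φ (e, a) (F (t n, p.2)) • s (e, a) (H p), .if ?_ ?_ ?_, ?_, ?_⟩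
    · rintro ⟨u, b⟩ ⟨⟨-, hb⟩, hfr⟩
      have hu : u = t n := frontier_le_subset_eq continuous_fst continuous_const hfr
      subst hu
      have h1 := hφs (e, a) (F (t n, b)) (by
        rw [mem_preimage, hF' b hb.1]; exact hUv _ _ htn hb.2)
      rw [hF' b hb.1] at h1
      exact h1.symm
    · refine hF.mono ?_
      rintro ⟨u, b⟩ ⟨⟨hu, hb⟩, hcl⟩
      rw [closure_le_eq continuous_fst continuous_const] at hcl
      exact ⟨⟨hu.1, hcl⟩, hb.1⟩
    · have hsub : ∀ p ∈ Icc 0 (t (n + 1)) ×ˢ (N ∩ v) ∩ closure {p : I × A | ¬p.1 ≤ t n},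
          p.1 ∈ Icc (t n) (t (n + 1)) ∧ p.2 ∈ N ∧ p.2 ∈ v := by
        rintro ⟨u, b⟩ ⟨⟨hu, hb⟩, hcl⟩
        simp only [not_le] at hcl
        exact ⟨⟨closure_lt_subset_le continuous_const continuous_fst hcl, hu.2⟩, hb⟩
      refine ContinuousOn.smul ?_ ?_
      · refine (hφ (e, a)).comp (hF.comp (by fun_prop) ?_) ?_
        · intro p hp
          exact ⟨⟨(t n).2.1, le_rfl⟩, (hsub p hp).2.1⟩
        · intro p hp
          rw [mem_preimage, hF' _ (hsub p hp).2.1]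
          exact hUv _ _ htn (hsub p hp).2.2
      · exact (hs (e, a)).comp H.continuous.continuousOn fun p hp =>
          hUv _ _ (hsub p hp).1 (hsub p hp).2.2
    · rintro ⟨u, b⟩ ⟨hu, hb⟩
      simp only
      split_ifs with h
      · exact hqF _ ⟨⟨hu.1, h⟩, hb.1⟩
      · rw [← (hfib _ _).2 ⟨_, rfl⟩]
        exact hqs _ _ (hUv _ _ ⟨(not_le.1 h).le, hu.2⟩ hb.2)
    · intro b hb
      exact (if_pos (t n).2.1).trans (hF0 b hb.1)

/-- The homotopy lifting property of principal torus bundles, for paracompact parameter spaces. -/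
theorem exists_homotopy_lift [ParacompactSpace A] [T2Space A] {q : X → B}
    (hq : Topology.IsQuotientMap q) (hfib : ∀ x y, q x = q y ↔ ∃ k : K, k • x = y)
    (e : K ≃ₜ* (κ → Circle)) (H : C(I × A, B)) (hH : ∀ p, IsTrivialNear K q (H p)) (f : C(A, X))
    (hf : ∀ a, q (f a) = H (0, a)) :
    ∃ F : C(I × A, X), (∀ p, q (F p) = H p) ∧ ∀ a, F (0, a) = f a := by
  choose N hNo hN F hF hqF hF0 using exists_local_lift hq hfib H hH f hf
  have hfree : ∀ i u a, a ∈ N i → ∀ k k' : K, k • F i (u, a) = k' • F i (u, a) → k = k' := by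
    intro i u a ha k k' h
    refine smul_injective_of_isTrivialNear (q := q) ?_ h
    rw [hqF i _ ⟨mem_univ _, ha⟩]
    exact hH _
  -- Two local lifts agree at time 0, so their difference in the torus starts at 1 and has a
  -- logarithm starting at 0.
  have hΔ : ∀ i j, ∃ δ : I × (N i ∩ N j : Set A) → κ → ℝ, Continuous δ ∧ (∀ a, δ (0, a) = 0) ∧
      ∀ p, torusExp e (δ p) • F i (p.1, p.2) = F j (p.1, p.2) := by
    intro i j
    have hx : Continuous fun p : I × (N i ∩ N j : Set A) => F i (p.1, p.2) :=
      (hF i).comp_continuous (by fun_prop) fun p => ⟨mem_univ _, p.2.2.1⟩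
    have hy : Continuous fun p : I × (N i ∩ N j : Set A) => F j (p.1, p.2) :=
      (hF j).comp_continuous (by fun_prop) fun p => ⟨mem_univ _, p.2.2.2⟩
    have hxq : ∀ p : I × (N i ∩ N j : Set A), q (F i (p.1, p.2)) = H (p.1, p.2) :=
      fun p => hqF i _ ⟨mem_univ _, p.2.2.1⟩
    have hyq : ∀ p : I × (N i ∩ N j : Set A), q (F j (p.1, p.2)) = H (p.1, p.2) :=
      fun p => hqF j _ ⟨mem_univ _, p.2.2.2⟩
    choose k hk using fun p => (hfib _ _).1 ((hxq p).trans (hyq p).symm)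
    have hkc : Continuous k := continuous_of_smul_eq hx hy hq.continuous
      (fun p => (hxq p).trans (hyq p).symm) (fun p => by rw [hxq]; exact hH _) hk
    obtain ⟨δ, hδ, hδ0, hδe⟩ := exists_log e hkc (by
      intro a
      refine hfree i 0 a a.2.1 _ _ ?_
      rw [hk (0, a), one_smul, hF0 i _ a.2.1, hF0 j _ a.2.2])
    exact ⟨δ, hδ, hδ0, fun p => by rw [hδe, hk]⟩
  choose δ hδ hδ0 hδe using hΔ
  classical
  let Δ : A → A → I → A → κ → ℝ := fun i j u a =>
    if h : a ∈ N i ∩ N j then δ i j (u, ⟨a, h⟩) else 0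
  have hΔc : ∀ i j u a, a ∈ N i → a ∈ N j →
      ContinuousAt (fun p : I × A => Δ i j p.1 p.2) (u, a) := by
    intro i j u a hi hj
    have : ContinuousOn (fun p : I × A => Δ i j p.1 p.2) (univ ×ˢ (N i ∩ N j)) := by
      rw [continuousOn_iff_continuous_domRestrict]
      have h2 : Continuous fun p : (univ ×ˢ (N i ∩ N j) : Set (I × A)) =>
          δ i j (p.1.1, ⟨p.1.2, p.2.2⟩) := (hδ i j).comp (by fun_prop)
      refine h2.congr fun p => ?_
      simp only [Δ, domRestrict_apply]
      rw [dif_pos p.2.2]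
    exact this.continuousAt ((isOpen_univ.prod ((hNo i).inter (hNo j))).mem_nhds
      ⟨mem_univ _, hi, hj⟩)
  have hΔe : ∀ i j u a, a ∈ N i → a ∈ N j →
      torusExp e (Δ i j u a) • F i (u, a) = F j (u, a) := by
    intro i j u a hi hj
    simp only [Δ]
    rw [dif_pos ⟨hi, hj⟩]
    exact hδe i j (u, ⟨a, hi, hj⟩)
  have hΔ0 : ∀ i j a, Δ i j 0 a = 0 := by
    intro i j a
    simp only [Δ]
    split_ifs
    · exact hδ0 _ _ _
    · rfl
  -- Both sides are logarithms of the same path in the torus and vanish at time 0.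
  have hcoc : ∀ i j l u a, a ∈ N i → a ∈ N j → a ∈ N l →
      Δ i l u a = Δ i j u a + Δ j l u a := by
    intro i j l u a hi hj hl
    have hc : ∀ i j, a ∈ N i → a ∈ N j → Continuous fun u => Δ i j u a := by
      intro i j hi hj
      rw [continuous_iff_continuousAt]
      intro u
      exact (hΔc i j u a hi hj).comp (f := fun u => (u, a)) (by fun_prop)
    refine congrFun (eq_of_torusExp_eq e (hc i l hi hl) ((hc i j hi hj).add (hc j l hj hl))
      (fun u => ?_) (z₀ := 0) (by simp [hΔ0])) u
    refine hfree i u a hi _ _ ?_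
    rw [hΔe i l u a hi hl, Pi.add_apply, add_comm, torusExp_add, mul_smul, hΔe i j u a hi hj,
      hΔe j l u a hj hl]
  obtain ⟨ρ, hρ⟩ := PartitionOfUnity.exists_isSubordinate isClosed_univ N hNo
    fun a _ => mem_iUnion.2 ⟨a, hN a⟩
  have hmem : ∀ a, ∀ j ∈ ρ.finsupport a, a ∈ N j := by
    intro a j hj
    rw [PartitionOfUnity.mem_finsupport] at hj
    exact hρ j (subset_tsupport _ hj)
  let S : A → I → A → κ → ℝ := fun i u a => ∑ j ∈ ρ.finsupport a, ρ j a • Δ i j u a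
  let G : I × A → X := fun p => torusExp e (S p.2 p.1 p.2) • F p.2 p
  have hG : ∀ i u a, a ∈ N i → G (u, a) = torusExp e (S i u a) • F i (u, a) := by
    intro i u a hi
    have : S i u a = S a u a + Δ i a u a := by
      simp only [S]
      rw [← one_smul ℝ (Δ i a u a), ← ρ.sum_finsupport (mem_univ a), Finset.sum_smul,
        ← Finset.sum_add_distrib]
      refine Finset.sum_congr rfl fun j hj => ?_
      rw [← smul_add, hcoc i a j u a hi (hN a) (hmem a j hj), add_comm]
    rw [this, torusExp_add, mul_smul, hΔe i a u a hi (hN a)]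
  refine ⟨⟨G, ?_⟩, ?_, ?_⟩
  · rw [continuous_iff_continuousAt]
    rintro ⟨u, a⟩
    have hev : ∀ᶠ p in 𝓝 (u, a), p.2 ∈ N a :=
      continuous_snd.continuousAt.eventually ((hNo a).mem_nhds (hN a))
    have hev2 : ∀ᶠ p in 𝓝 (u, a), ρ.finsupport p.2 ⊆ ρ.fintsupport a :=
      (continuous_snd.tendsto (u, a)).eventually (ρ.eventually_finsupport_subset a)
    have hc : ContinuousAt (fun p : I × A => torusExp e
        (∑ j ∈ ρ.fintsupport a, ρ j p.2 • Δ a j p.1 p.2) • F a p) (u, a) := by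
      refine ContinuousAt.smul ((continuous_torusExp e).continuousAt.comp ?_)
        ((hF a).continuousAt ((isOpen_univ.prod (hNo a)).mem_nhds ⟨mem_univ _, hN a⟩))
      refine tendsto_finsetSum _ fun j hj => ?_
      have : a ∈ N j := hρ j ((ρ.mem_fintsupport_iff a j).1 hj)
      exact ContinuousAt.smul ((ρ j).continuous.comp continuous_snd).continuousAt
        (hΔc a j u a (hN a) this)
    refine hc.congr ?_
    filter_upwards [hev, hev2] with p hp hp2
    rw [show p = (p.1, p.2) from rfl, hG a p.1 p.2 hp]
    congr 2
    refine (Finset.sum_subset hp2 fun j _ hj => ?_).symm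
    rw [PartitionOfUnity.mem_finsupport, Function.notMem_support] at hj
    rw [hj, zero_smul]
  · rintro ⟨u, a⟩
    change q (torusExp e _ • F a (u, a)) = _
    rw [← (hfib _ _).2 ⟨_, rfl⟩, hqF a _ ⟨mem_univ _, hN a⟩]
  · intro a
    change torusExp e _ • F a (0, a) = _
    simp only [S, hΔ0, smul_zero, Finset.sum_const_zero, torusExp_zero, one_smul]
    exact hF0 a a (hN a)

end Principal

/-! ### Phases and real lifts -/

section Phase

/-- The phase `z / ‖z‖` of a complex number, with value `1` at zero. -/
def phase (z : ℂ) : Circle := Circle.exp z.arg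

theorem norm_mul_phase (z : ℂ) : (‖z‖ : ℂ) * phase z = z := by
  rw [phase, Circle.coe_exp, Complex.norm_mul_exp_arg_mul_I]

theorem coe_phase {z : ℂ} (hz : z ≠ 0) : (phase z : ℂ) = z / ‖z‖ := by
  rw [eq_div_iff (by simpa using hz), mul_comm, norm_mul_phase]

theorem phase_eq_of_mul {z : ℂ} {r : ℝ} {t : Circle} (hr : 0 < r) (h : (r : ℂ) * t = z) :
    phase z = t := by
  have hn : ‖z‖ = r := by rw [← h]; simp [abs_of_pos hr, Circle.norm_coe]
  have h2 := norm_mul_phase z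
  rw [hn] at h2
  exact Circle.ext (mul_left_cancel₀ (Complex.ofReal_ne_zero.2 hr.ne') (h2.trans h.symm))

theorem phase_mul (t : Circle) {z : ℂ} (hz : z ≠ 0) : phase (t * z) = t * phase z := by
  refine phase_eq_of_mul (r := ‖z‖) (by simpa using hz) ?_
  rw [Circle.coe_mul, mul_left_comm, norm_mul_phase]

theorem isInducing_circle_coe : Topology.IsInducing fun z : Circle => (z : ℂ) := ⟨rfl⟩

theorem continuousAt_phase {z : ℂ} (hz : z ≠ 0) : ContinuousAt phase z := by
  have h : ContinuousAt (fun w : ℂ => w / ‖w‖) z :=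
    ContinuousAt.div continuousAt_id (by fun_prop) (by simpa using hz)
  rw [isInducing_circle_coe.continuousAt_iff]
  refine h.congr ?_
  filter_upwards [isOpen_ne.mem_nhds hz] with w hw
  exact (coe_phase hw).symm

theorem exists_circle_mul_eq {z w : ℂ} (h : ‖z‖ = ‖w‖) : ∃ t : Circle, t * z = w := by
  refine ⟨phase w * (phase z)⁻¹, ?_⟩
  nth_rewrite 2 [← norm_mul_phase z]
  rw [h, mul_comm, Circle.coe_mul, mul_assoc, mul_left_comm (phase z : ℂ), ← Circle.coe_mul,
    mul_inv_cancel, Circle.coe_one, mul_one, norm_mul_phase]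

/-- Rescaling a complex function to a prescribed modulus is continuous if the modulus vanishes at
the zeros of the function. -/
theorem continuous_mul_phase {X : Type*} [TopologicalSpace X] {f : X → ℂ} {g : X → ℝ}
    (hf : Continuous f) (hg : Continuous g) (h : ∀ x, f x = 0 → g x = 0) :
    Continuous fun x => (g x : ℂ) * phase (f x) := by
  rw [continuous_iff_continuousAt]
  intro x
  by_cases hx : f x = 0
  · have h0 : Tendsto (fun y => ‖(g y : ℂ) * phase (f y)‖) (𝓝 x) (𝓝 0) := by
      have : Tendsto (fun y => ‖g y‖) (𝓝 x) (𝓝 0) := by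
        have := hg.norm.tendsto x
        rwa [h x hx, norm_zero] at this
      refine this.congr fun y => ?_
      simp [Circle.norm_coe]
    have := tendsto_zero_iff_norm_tendsto_zero.2 h0
    rw [ContinuousAt, h x hx]
    simpa using this
  · have h1 : ContinuousAt (fun y => (phase (f y) : ℂ)) x :=
      isInducing_circle_coe.continuous.continuousAt.comp
        ((continuousAt_phase hx).comp hf.continuousAt)
    exact (Complex.continuous_ofReal.comp hg).continuousAt.mul h1

end Phase

section RealLift

variable {κ K V Z : Type*} [CommGroup K] [TopologicalSpace K] [TopologicalSpace Z]
  [AddCommGroup V] [Module ℝ V] [TopologicalSpace V] [ContinuousSMul ℝ V]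

/-- A map from a contractible set to a torus has a logarithm. -/
theorem exists_log_of_contractible [IsTopologicalGroup K] (e : K ≃ₜ* (κ → Circle)) {C : Set Z}
    [ContractibleSpace C] {g : Z → K} (hg : ContinuousOn g C) :
    ∃ v : Z → κ → ℝ, ContinuousOn v C ∧ ∀ x ∈ C, torusExp e (v x) = g x := by
  classical
  obtain ⟨b, ⟨G⟩⟩ := id_nullhomotopic C
  -- The reversed contraction starts at the constant `b`, so this quotient starts at 1; a logarithm
  -- `c` of `g b` is added back at the end.
  have hk : Continuous fun p : I × C => g (G.symm p) * (g b)⁻¹ :=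
    (hg.comp_continuous (by fun_prop) fun p => (G.symm p).2).mul continuous_const
  obtain ⟨δ, hδ, -, hδe⟩ := exists_log e hk (by simp)
  choose c hc using fun i => Circle.exp_surjective (e (g b) i)
  refine ⟨fun x => if h : x ∈ C then δ (1, ⟨x, h⟩) + c else 0, ?_, ?_⟩
  · rw [continuousOn_iff_continuous_domRestrict]
    have : Continuous fun x : C => δ (1, x) + c := by fun_prop
    refine this.congr fun x => ?_
    simp
  · intro x hx
    have h1 := hδe (1, ⟨x, hx⟩)
    have h2 : torusExp e c = g b := (torusExp_eq_iff e).2 hc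
    simp only [hx, dif_pos, torusExp_add, h1, h2]
    simp

/-- A continuous character of a real vector space is the exponential of a linear form. -/
theorem exists_linear_of_character {χ : V → Circle} (hχ : Continuous χ)
    (hadd : ∀ v w, χ (v + w) = χ v * χ w) : ∃ a : V →L[ℝ] ℝ, ∀ v, χ v = Circle.exp (a v) := by
  let e : (Unit → Circle) ≃ₜ* (Unit → Circle) := ContinuousMulEquiv.refl _
  have h0 : χ 0 = 1 := by
    have := hadd 0 0
    rwa [add_zero, left_eq_mul] at this
  -- Lift `χ` along each ray from 0. The value at time 1 is additive by uniqueness of lifts, and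
  -- being continuous it is linear.
  obtain ⟨δ, hδ, hδ0, hδe⟩ := exists_log (A := V) e
    (k := fun p _ => χ ((p.1 : ℝ) • p.2)) (by fun_prop) (by intro a; funext; simp [h0])
  have hadd' : ∀ v w, δ (1, v + w) = δ (1, v) + δ (1, w) := by
    intro v w
    refine congrFun (eq_of_torusExp_eq (Z := I) e (v := fun u => δ (u, v + w))
      (w := fun u => δ (u, v) + δ (u, w)) (by fun_prop) (by fun_prop) (fun u => ?_) (z₀ := 0)
      (by simp [hδ0])) 1
    rw [torusExp_add, hδe, hδe, hδe]
    funext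
    simp [hadd]
  let a : V →+ ℝ := ⟨⟨fun v => δ (1, v) (), by
    have := hadd' 0 0
    rw [add_zero, left_eq_add] at this
    rw [this]; rfl⟩, fun v w => by simp [hadd']⟩
  have ha : Continuous a := by
    change Continuous fun v => δ (1, v) ()
    fun_prop
  refine ⟨a.toRealLinearMap ha, fun v => ?_⟩
  have := ((torusExp_eq_iff e).1 (hδe (1, v))) ()
  simp only [Icc.coe_one, one_smul] at this
  exact this.symm

end RealLift

/-! ### Facets of polytopes -/

section Facets

variable {E : Type*} [NormedAddCommGroup E] [NormedSpace ℝ E] {P : Set E}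

/-- The set of facets containing a point. -/
def facetsAt (P : Set E) (p : E) : Set (Facet P) := {F | p ∈ F.1}

theorem ncard_facetsAt (p : E) : (facetsAt P p).ncard = facetDepth P p := by
  rw [facetDepth, ← ncard_image_of_injective _ Subtype.val_injective]
  congr 1
  ext F
  simp only [mem_image, mem_ofPred_eq, facetsAt, Subtype.exists, exists_and_left, exists_prop,
    exists_eq_right_right]
  tauto

/-- The functional exposing a facet attains its maximum over `P` exactly there; subtract it from the
maximum. -/
theorem Facet.exists_slack (F : Facet P) :
    ∃ f : (E →L[ℝ] ℝ) × ℝ, (∀ p ∈ P, 0 ≤ f.2 - f.1 p) ∧ ∀ p ∈ P, f.2 - f.1 p = 0 ↔ p ∈ F.1 := by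
  obtain ⟨⟨y, hy⟩, hexp, -⟩ := F.2
  obtain ⟨l, hl⟩ := hexp ⟨y, hy⟩
  have hy' := hy
  rw [hl] at hy'
  refine ⟨(l, l y), fun p hp => sub_nonneg.2 (hy'.2 p hp), fun p hp => ?_⟩
  rw [hl, sub_eq_zero]
  exact ⟨fun h => ⟨hp, fun z hz => h ▸ hy'.2 z hz⟩, fun h => le_antisymm (h.2 y hy'.1)
    (hy'.2 p hp)⟩

/-- An affine function which is nonnegative on `P` and whose zero set in `P` is the facet `F`. -/
def slack (F : Facet P) (x : E) : ℝ := F.exists_slack.choose.2 - F.exists_slack.choose.1 x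

theorem continuous_slack (F : Facet P) : Continuous (slack F) := by
  unfold slack
  fun_prop

theorem slack_sum (F : Facet P) {α : Type*} (s : Finset α) (w : α → ℝ) (hw : ∑ i ∈ s, w i = 1)
    (b : α → E) : slack F (∑ i ∈ s, w i • b i) = ∑ i ∈ s, w i * slack F (b i) := by
  simp only [slack, map_sum, map_smul, smul_eq_mul, mul_sub, Finset.sum_sub_distrib,
    ← Finset.sum_mul, hw, one_mul]

theorem slack_lineMap (F : Facet P) (x y : E) (u : ℝ) :
    slack F ((1 - u) • x + u • y) = (1 - u) * slack F x + u * slack F y := by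
  simp only [slack, map_add, map_smul, smul_eq_mul]
  ring

theorem slack_nonneg (F : Facet P) {p : E} (hp : p ∈ P) : 0 ≤ slack F p :=
  F.exists_slack.choose_spec.1 p hp

theorem slack_eq_zero (F : Facet P) {p : E} (hp : p ∈ P) : slack F p = 0 ↔ F ∈ facetsAt P p :=
  F.exists_slack.choose_spec.2 p hp

theorem slack_pos (F : Facet P) {p : E} (hp : p ∈ P) : 0 < slack F p ↔ F ∉ facetsAt P p := by
  rw [← slack_eq_zero F hp, (slack_nonneg F hp).lt_iff_ne, ne_comm]

theorem IsConvexPolytope.isCompact (hP : IsConvexPolytope P) : IsCompact P := by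
  obtain ⟨s, hs, -, rfl⟩ := hP
  exact hs.isCompact_convexHull (𝕜 := ℝ)

theorem IsConvexPolytope.convex (hP : IsConvexPolytope P) : Convex ℝ P := by
  obtain ⟨s, hs, -, rfl⟩ := hP
  exact convex_convexHull ℝ s

theorem Facet.subset (F : Facet P) : F.1 ⊆ P := F.2.2.1.subset

theorem IsConvexPolytope.isCompact_facet (hP : IsConvexPolytope P) (F : Facet P) :
    IsCompact F.1 := F.2.2.1.isCompact hP.isCompact

/-- By Krein–Milman a facet is determined by its extreme points, which belong to the finite set
spanning `P`. -/
theorem IsConvexPolytope.finite_facet (hP : IsConvexPolytope P) : Finite (Facet P) := by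
  obtain ⟨s, hs, -, hPs⟩ := id hP
  have hinj : Function.Injective fun F : Facet P => (F.1.extremePoints ℝ) := by
    intro F G h
    apply Subtype.ext
    rw [← closure_convexHull_extremePoints (E := E) (hP.isCompact_facet F)
      (F.2.2.1.convex hP.convex),
      ← closure_convexHull_extremePoints (E := E) (hP.isCompact_facet G)
      (G.2.2.1.convex hP.convex)]
    simp only at h
    rw [h]
  have hsub : range (fun F : Facet P => (F.1.extremePoints ℝ)) ⊆ 𝒫 s := by
    rintro _ ⟨F, rfl⟩
    refine ((F.2.2.1.isExtreme (𝕜 := ℝ)).extremePoints_subset_extremePoints).trans ?_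
    rw [hPs]
    exact extremePoints_convexHull_subset
  have := (hs.finite_subsets.subset hsub).to_subtype
  exact Finite.of_injective_finite_range hinj

/-- Every point of a simple polytope lies in no facets but those through some vertex. -/
theorem IsSimplePolytope.exists_vertex {n : ℕ} (hP : IsSimplePolytope n P) {p : E} (hp : p ∈ P) :
    ∃ v ∈ P, facetsAt P p ⊆ facetsAt P v ∧ (facetsAt P v).ncard = n := by
  have hc := hP.isConvexPolytope.isCompact
  -- The intersection of the facets through `p` is extreme in `P` and compact, so it contains an
  -- extreme point, which is then a vertex of `P`.
  have hG : IsExtreme ℝ P (P ∩ ⋂ F ∈ facetsAt P p, F.1) := by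
    refine ⟨inter_subset_left, fun x hx y hy z hz hxy => ⟨hx, mem_iInter₂.2 fun F hF => ?_⟩⟩
    exact (F.2.2.1.isExtreme (𝕜 := ℝ)).left_mem_of_mem_openSegment hx hy
      (mem_iInter₂.1 hz.2 F hF) hxy
  have hGc : IsCompact (P ∩ ⋂ F ∈ facetsAt P p, F.1) :=
    hc.inter_right (isClosed_biInter fun F _ => (hP.isConvexPolytope.isCompact_facet F).isClosed)
  obtain ⟨v, hv⟩ := hGc.extremePoints_nonempty ⟨p, hp, mem_iInter₂.2 fun F hF => hF⟩
  have hvP := hG.extremePoints_subset_extremePoints hv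
  refine ⟨v, hvP.1, fun F hF => mem_iInter₂.1 hv.1.2 F hF, ?_⟩
  rw [ncard_facetsAt]
  exact hP.facets_at_vertex v hvP

/-- A stratum is cut out by the vanishing or strict positivity of affine functions. Convexity makes
it connected, for the constancy of stabilizers, and contractible when nonempty, for the section over
the interior. -/
theorem convex_facetsAt_eq (hP : Convex ℝ P) (s : Set (Facet P)) :
    Convex ℝ {p | p ∈ P ∧ facetsAt P p = s} := by
  have : {p | p ∈ P ∧ facetsAt P p = s} =
      {p | p ∈ P ∧ ∀ F : Facet P, (F ∈ s → slack F p = 0) ∧ (F ∉ s → 0 < slack F p)} := by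
    ext p
    simp only [mem_ofPred_eq, and_congr_right_iff]
    intro hp
    constructor
    · rintro rfl F
      exact ⟨(slack_eq_zero F hp).2, (slack_pos F hp).2⟩
    · intro h
      ext F
      by_cases hF : F ∈ s
      · simp [hF, (slack_eq_zero F hp).1 ((h F).1 hF)]
      · simp [hF, (slack_pos F hp).1 ((h F).2 hF)]
  rw [this]
  rintro x ⟨hx, hx'⟩ y ⟨hy, hy'⟩ a b ha hb hab
  obtain rfl : a = 1 - b := by linarith
  refine ⟨hP hx hy ha hb hab, fun F => ⟨fun hF => ?_, fun hF => ?_⟩⟩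
  · rw [slack_lineMap, (hx' F).1 hF, (hy' F).1 hF]
    simp
  · rw [slack_lineMap]
    have h1 := (hx' F).2 hF
    have h2 := (hy' F).2 hF
    rcases hb.eq_or_lt with rfl | hb
    · simpa using h1
    · have := mul_nonneg ha h1.le
      have := mul_pos hb h2
      linarith

theorem isOpen_facetsAt_subset [Finite (Facet P)] (s : Set (Facet P)) :
    IsOpen {p : P | facetsAt P p ⊆ s} := by
  have : {p : P | facetsAt P p ⊆ s} = ⋂ F : Facet P, {p : P | F ∉ s → 0 < slack F p} := by
    ext p
    simp only [mem_ofPred_eq, mem_iInter]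
    refine forall_congr' fun F => ?_
    rw [slack_pos F p.2]
    tauto
  rw [this]
  refine isOpen_iInter_of_finite fun F => ?_
  by_cases hF : F ∈ s
  · simp [hF]
  · simp only [hF, not_false_eq_true, forall_const]
    exact isOpen_lt continuous_const ((continuous_slack F).comp continuous_subtype_val)

end Facets

/-! ### Standard charts -/

namespace StandardChart

variable {n : ℕ} {M : Type*} [TopologicalSpace M] [MulAction (Torus n) M] (c : StandardChart n M)

/-- The coordinates of a point which vanish in the chart. -/
def zeros (x : M) : Set (Fin n) := {i | c.chart x i = 0}

theorem chart_smul_apply (t : Torus n) {x : M} (hx : x ∈ c.chart.source) (i : Fin n) :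
    c.chart (t • x) i = (c.aut t i : ℂ) * c.chart x i := by
  rw [c.chart_smul t x hx]

/-- The chart is injective on its source, and a nonzero coordinate is fixed only by 1. In the chart,
stabilizers are therefore coordinate subtori. -/
theorem smul_eq_self_iff (t : Torus n) {x : M} (hx : x ∈ c.chart.source) :
    t • x = x ↔ ∀ i ∉ c.zeros x, c.aut t i = 1 := by
  constructor
  · intro h i hi
    have h2 := c.chart_smul_apply t hx i
    rw [h] at h2
    exact Circle.ext (by simpa using (mul_eq_right₀ hi).1 h2.symm)
  · intro h
    refine c.chart.injOn (c.smul_mem_source t x hx) hx ?_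
    funext i
    rw [c.chart_smul_apply t hx]
    by_cases hi : i ∈ c.zeros x
    · rw [show c.chart x i = 0 from hi, mul_zero]
    · rw [h i hi, Circle.coe_one, one_mul]

/-- Points of the target with coordinates of the same modulus come from the same orbit. -/
theorem exists_smul_symm {z w : Fin n → ℂ} (hz : z ∈ c.chart.target) (h : ∀ i, ‖z i‖ = ‖w i‖) :
    w ∈ c.chart.target ∧ ∃ t : Torus n, t • c.chart.symm z = c.chart.symm w := by
  choose u hu using fun i => exists_circle_mul_eq (h i)
  have hs : c.chart.symm z ∈ c.chart.source := c.chart.map_target hz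
  have hs' := c.smul_mem_source (c.aut.symm u) _ hs
  have hw : c.chart (c.aut.symm u • c.chart.symm z) = w := by
    funext i
    rw [c.chart_smul_apply _ hs, c.chart.right_inv hz, ← hu i]
    rw [c.aut.apply_symm_apply]
  exact ⟨hw ▸ c.chart.map_source hs', c.aut.symm u, by rw [← hw, c.chart.left_inv hs']⟩

theorem norm_chart_smul (t : Torus n) {x : M} (hx : x ∈ c.chart.source) (i : Fin n) :
    ‖c.chart (t • x) i‖ = ‖c.chart x i‖ := by
  rw [c.chart_smul_apply t hx, norm_mul, Circle.norm_coe, one_mul]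

/-- Near any point, the set of vanishing coordinates does not grow. -/
theorem eventually_zeros_subset {x : M} (hx : x ∈ c.chart.source) :
    ∀ᶠ y in 𝓝 x, y ∈ c.chart.source ∧ c.zeros y ⊆ c.zeros x := by
  have hsrc : ∀ᶠ y in 𝓝 x, y ∈ c.chart.source := c.chart.open_source.mem_nhds hx
  refine hsrc.and ?_
  have : ∀ i, ∀ᶠ y in 𝓝 x, i ∈ c.zeros y → i ∈ c.zeros x := by
    intro i
    by_cases hi : i ∈ c.zeros x
    · exact Eventually.of_forall fun _ _ => hi
    · have h1 : ContinuousAt (fun y => c.chart y i) x :=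
        (continuous_apply i).continuousAt.comp (c.chart.continuousAt hx)
      filter_upwards [h1.eventually_ne hi] with y hy hy'
      exact absurd hy' hy
  filter_upwards [eventually_all.2 this] with y hy i
  exact hy i

/-- Any of the vanishing coordinates of a point may be made nonzero by a small perturbation. -/
theorem exists_near_zeros_eq {x : M} (hx : x ∈ c.chart.source) {J : Set (Fin n)}
    (hJ : J ⊆ c.zeros x) {W : Set M} (hW : W ∈ 𝓝 x) :
    ∃ y ∈ W, y ∈ c.chart.source ∧ c.zeros y = J := by
  classical
  let z : ℝ → Fin n → ℂ := fun r i => if i ∈ c.zeros x ∧ i ∉ J then (r : ℂ) else c.chart x i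
  have hzc : Continuous z := by
    refine continuous_pi fun i => ?_
    simp only [z]
    split_ifs <;> fun_prop
  have hz0 : z 0 = c.chart x := by
    funext i
    simp only [z, Complex.ofReal_zero]
    split_ifs with h
    · exact (show c.chart x i = 0 from h.1).symm
    · rfl
  have ht : Tendsto z (𝓝 0) (𝓝 (c.chart x)) := hz0 ▸ hzc.tendsto 0
  have h1 : ∀ᶠ r in 𝓝 (0 : ℝ), z r ∈ c.chart.target :=
    ht.eventually (c.chart.open_target.mem_nhds (c.chart.map_source hx))
  have h2 : ∀ᶠ r in 𝓝 (0 : ℝ), c.chart.symm (z r) ∈ W := by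
    have := c.chart.continuousAt_symm (c.chart.map_source hx)
    rw [ContinuousAt, c.chart.left_inv hx] at this
    exact (this.comp ht).eventually hW
  obtain ⟨r, ⟨hr1, hr2⟩, hr⟩ := (((h1.and h2).filter_mono nhdsWithin_le_nhds).and
    (self_mem_nhdsWithin : {(0 : ℝ)}ᶜ ∈ 𝓝[≠] 0)).exists
  refine ⟨c.chart.symm (z r), hr2, c.chart.map_target hr1, ?_⟩
  ext i
  simp only [zeros, mem_ofPred_eq]
  rw [c.chart.right_inv hr1]
  simp only [z]
  have hr0 : (r : ℂ) ≠ 0 := Complex.ofReal_ne_zero.2 hr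
  constructor
  · intro h
    split_ifs at h with h'
    · exact absurd h hr0
    · by_contra hi
      exact h' ⟨h, hi⟩
  · intro hi
    rw [if_neg (fun h => h.2 hi)]
    exact hJ hi

end StandardChart

/-! ### The orbit map -/

variable {E : Type*} [NormedAddCommGroup E] [NormedSpace ℝ E]

/-- The orbit map of a quasitoric manifold, as a map to the polytope. -/
structure OrbitMap (n : ℕ) (M : Type*) [TopologicalSpace M] [MulAction (Torus n) M]
    (P : Set E) where
  exists_chart : ∀ x : M, ∃ c : StandardChart n M, x ∈ c.chart.source
  convex : Convex ℝ P
  /-- The map to the polytope. -/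
  toFun : M → P
  isQuotientMap : Topology.IsQuotientMap toFun
  isOpenMap : IsOpenMap toFun
  eq_iff : ∀ x y, toFun x = toFun y ↔ ∃ t : Torus n, t • x = y
  ncard_zeros : ∀ (x : M) (c : StandardChart n M), x ∈ c.chart.source →
    (c.zeros x).ncard = (facetsAt P (toFun x : E)).ncard

variable {n : ℕ} {M : Type*} [TopologicalSpace M] [MulAction (Torus n) M] {P : Set E}

theorem IsQuasitoricManifold.exists_orbitMap (h : IsQuasitoricManifold n M P)
    (hP : IsConvexPolytope P) :
    Nonempty (OrbitMap n M P) := by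
  obtain ⟨e, he⟩ := h.orbitSpace
  have := h.continuousSMul
  refine ⟨⟨h.locallyStandard, hP.convex, fun x => e (Quotient.mk _ x),
    e.isQuotientMap.comp isQuotientMap_quotient_mk',
    e.isOpenMap.comp isOpenMap_quotient_mk'_mul, fun x y => ?_, fun x c hx => ?_⟩⟩
  · rw [e.injective.eq_iff, eq_comm, Quotient.eq]
    exact Iff.rfl
  · rw [ncard_facetsAt, ← he x c hx]
    rfl

namespace OrbitMap

variable (π : OrbitMap n M P)

theorem continuous : Continuous π.toFun := π.isQuotientMap.continuous

theorem toFun_smul (t : Torus n) (x : M) : π.toFun (t • x) = π.toFun x :=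
  ((π.eq_iff _ _).2 ⟨t, rfl⟩).symm

/-- The torus is commutative, so all points of an orbit have the same stabilizer. -/
theorem stabilizer_eq {x y : M} (h : π.toFun x = π.toFun y) (t : Torus n) :
    t • x = x ↔ t • y = y := by
  obtain ⟨u, rfl⟩ := (π.eq_iff x y).1 h
  rw [smul_comm, smul_left_cancel_iff]

theorem eventually_facetsAt_subset [Finite (Facet P)] (x : M) :
    ∀ᶠ y in 𝓝 x, facetsAt P (π.toFun y : E) ⊆ facetsAt P (π.toFun x : E) :=
  π.continuous.continuousAt.eventually ((isOpen_facetsAt_subset _).mem_nhds Subset.rfl)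

/-- The stabilizer is constant over the relative interior of a facet. -/
theorem stabilizer_eq_of_facetsAt [Finite (Facet P)] {F : Facet P} {x y : M}
    (hx : facetsAt P (π.toFun x : E) = {F}) (hy : facetsAt P (π.toFun y : E) = {F}) :
    MulAction.stabilizer (Torus n) x = MulAction.stabilizer (Torus n) y := by
  obtain ⟨r, hr⟩ := π.isQuotientMap.surjective.hasRightInverse
  let R : Set P := {p | facetsAt P (p : E) = {F}}
  have hst : ∀ x y, π.toFun x = π.toFun y →
      MulAction.stabilizer (Torus n) x = MulAction.stabilizer (Torus n) y := fun x y h => by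
    ext t
    exact π.stabilizer_eq h t
  have hR : IsPreconnected R := by
    rw [← Topology.IsInducing.subtypeVal.isPreconnected_image]
    have : (Subtype.val '' R : Set E) = {p | p ∈ P ∧ facetsAt P p = {F}} := by
      ext p
      simp [R, and_comm]
    rw [this]
    exact (convex_facetsAt_eq π.convex {F}).isPreconnected
  have : PreconnectedSpace R := isPreconnected_iff_preconnectedSpace.1 hR
  -- In a chart the zero set of a nearby point is contained in that of the centre; over the stratum
  -- both have the same cardinality, so they coincide, and they determine the stabilizers.
  have hloc : IsLocallyConstant fun p : R => MulAction.stabilizer (Torus n) (r p) := by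
    rw [IsLocallyConstant.iff_eventually_eq]
    rintro ⟨p, hp⟩
    obtain ⟨c, hcp⟩ := π.exists_chart (r p)
    have h1 := π.isOpenMap.image_mem_nhds (c.eventually_zeros_subset hcp)
    rw [hr] at h1
    have h2 := (continuous_subtype_val.tendsto (⟨p, hp⟩ : R)).eventually h1
    filter_upwards [h2] with q hq
    obtain ⟨y, ⟨hys, hyz⟩, hyq⟩ := hq
    have e1 : (c.zeros y).ncard = (c.zeros (r p)).ncard := by
      rw [π.ncard_zeros y c hys, π.ncard_zeros (r p) c hcp, hyq, hr, q.2, hp]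
    have e2 : c.zeros y = c.zeros (r p) := eq_of_subset_of_ncard_le hyz e1.ge
    rw [hst (r q) y (by rw [hr, hyq])]
    ext t
    rw [MulAction.mem_stabilizer_iff, MulAction.mem_stabilizer_iff, c.smul_eq_self_iff t hys,
      c.smul_eq_self_iff t hcp, e2]
  have h := hloc.apply_eq_of_preconnectedSpace ⟨π.toFun x, hx⟩ ⟨π.toFun y, hy⟩
  rw [hst x (r (π.toFun x)) (hr _).symm, hst y (r (π.toFun y)) (hr _).symm]
  exact h

end OrbitMap

/-! ### Characteristic circles of the facets and the characteristic homomorphism -/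

namespace OrbitMap

variable (π : OrbitMap n M P) [Finite (Facet P)]

/-- In a chart, the vanishing coordinates of a point correspond to the facets through its image,
in such a way that the corresponding circles are the stabilizers over these facets. -/
theorem exists_zeros_equiv (c : StandardChart n M) {x : M} (hx : x ∈ c.chart.source) :
    ∃ f : c.zeros x ≃ facetsAt P (π.toFun x : E), ∀ i, ∃ y : M,
      facetsAt P (π.toFun y : E) = {(f i).1} ∧
      ∀ t : Torus n, t • y = y ↔ ∀ k ≠ i.1, c.aut t k = 1 := by
  have key : ∀ i : c.zeros x, ∃ F : facetsAt P (π.toFun x : E), ∃ y : M,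
      facetsAt P (π.toFun y : E) = {F.1} ∧
      ∀ t : Torus n, t • y = y ↔ ∀ k ≠ i.1, c.aut t k = 1 := by
    intro i
    -- Perturb `x` until only coordinate `i` vanishes; the new point has depth one and so singles
    -- out a facet.
    obtain ⟨y, hyW, hys, hyz⟩ := c.exists_near_zeros_eq hx (singleton_subset_iff.2 i.2)
      (π.eventually_facetsAt_subset x)
    have h1 := π.ncard_zeros y c hys
    rw [hyz, ncard_singleton] at h1
    obtain ⟨F, hF⟩ := ncard_eq_one.1 h1.symm
    have hFx : F ∈ facetsAt P (π.toFun x : E) := hyW (hF ▸ mem_singleton F)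
    refine ⟨⟨F, hFx⟩, y, hF, fun t => ?_⟩
    rw [c.smul_eq_self_iff t hys, hyz]
    rfl
  choose f y hy hst using key
  have hinj : Function.Injective f := by
    intro i j hij
    have h1 := π.stabilizer_eq_of_facetsAt (hy i) (hij ▸ hy j)
    by_contra hne
    have hne' : i.1 ≠ j.1 := fun h => hne (Subtype.ext h)
    -- The element -1 of circle `i` fixes `y i`, but not `y j`, whose coordinate `i` is nonzero.
    have h2 : c.aut.symm (Pi.mulSingle i.1 (-1)) ∈ MulAction.stabilizer (Torus n) (y i) := by
      rw [MulAction.mem_stabilizer_iff, hst]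
      intro k hk
      rw [c.aut.apply_symm_apply, Pi.mulSingle_eq_of_ne hk]
    rw [h1, MulAction.mem_stabilizer_iff, hst] at h2
    have h3 := h2 i.1 hne'
    rw [c.aut.apply_symm_apply, Pi.mulSingle_eq_same] at h3
    have h4 := congrArg (fun z : Circle => (z : ℂ)) h3
    norm_num at h4
  have hbij : Function.Bijective f := by
    rw [Nat.bijective_iff_injective_and_card]
    exact ⟨hinj, π.ncard_zeros x c hx⟩
  exact ⟨Equiv.ofBijective f hbij, fun i => ⟨y i, hy i, hst i⟩⟩

/-- The stabilizers over the relative interior of a facet form a circle. -/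
theorem exists_facetHom (F : Facet P) : ∃ l : Circle →* Torus n, Continuous l ∧
    Function.Injective l ∧ ∀ y : M, facetsAt P (π.toFun y : E) = {F} →
      ∀ t : Torus n, t • y = y ↔ t ∈ range l := by
  obtain ⟨p, hp⟩ := F.2.1
  obtain ⟨x, hx⟩ := π.isQuotientMap.surjective ⟨p, F.subset hp⟩
  obtain ⟨c, hcx⟩ := π.exists_chart x
  obtain ⟨f, hf⟩ := π.exists_zeros_equiv c hcx
  have hF : F ∈ facetsAt P (π.toFun x : E) := by rw [hx]; exact hp
  obtain ⟨y, hy, hst⟩ := hf (f.symm ⟨F, hF⟩)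
  rw [f.apply_symm_apply] at hy
  set i := (f.symm ⟨F, hF⟩).1
  refine ⟨c.aut.symm.toMonoidHom.comp (MonoidHom.mulSingle (fun _ => Circle) i),
    c.aut.symm.continuous.comp (continuous_mulSingle (A := fun _ => Circle) i),
    c.aut.symm.injective.comp (Pi.mulSingle_injective (M := fun _ => Circle) i), fun z hz t => ?_⟩
  have h1 := π.stabilizer_eq_of_facetsAt hz hy
  rw [← MulAction.mem_stabilizer_iff, h1, MulAction.mem_stabilizer_iff, hst]
  constructor
  · intro h
    refine ⟨c.aut t i, ?_⟩
    change c.aut.symm (Pi.mulSingle i (c.aut t i)) = t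
    rw [← c.aut.symm_apply_apply t]
    congr 1
    funext k
    rw [c.aut.apply_symm_apply]
    by_cases hk : k = i
    · subst hk; simp
    · rw [h k hk, Pi.mulSingle_eq_of_ne hk]
  · rintro ⟨u, rfl⟩ k hk
    change c.aut (c.aut.symm (Pi.mulSingle i u)) k = 1
    rw [c.aut.apply_symm_apply, Pi.mulSingle_eq_of_ne hk]

/-- The characteristic circle of a facet: the stabilizers over its relative interior. -/
def facetHom (F : Facet P) : Circle →* Torus n := (π.exists_facetHom F).choose

theorem continuous_facetHom (F : Facet P) : Continuous (π.facetHom F) :=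
  (π.exists_facetHom F).choose_spec.1

/-- In a chart around `x`, the circles of the facets through `π x` are coordinate circles. -/
theorem exists_coordinate (c : StandardChart n M) {x : M} (hx : x ∈ c.chart.source) :
    ∃ f : facetsAt P (π.toFun x : E) ≃ c.zeros x, ∀ F,
      (∀ u, ∀ k ≠ (f F).1, c.aut (π.facetHom F.1 u) k = 1) ∧
      Function.Bijective fun u => c.aut (π.facetHom F.1 u) (f F) := by
  obtain ⟨f, hf⟩ := π.exists_zeros_equiv c hx
  refine ⟨f.symm, fun F => ?_⟩
  obtain ⟨y, hy, hst⟩ := hf (f.symm F)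
  rw [f.apply_symm_apply] at hy
  obtain ⟨-, hinj, hrange⟩ := (π.exists_facetHom F.1).choose_spec
  have h1 : ∀ u, ∀ k ≠ (f.symm F).1, c.aut (π.facetHom F.1 u) k = 1 := by
    intro u
    rw [← hst, hrange y hy]
    exact ⟨u, rfl⟩
  refine ⟨h1, fun u v huv => hinj (c.aut.injective ?_), fun u => ?_⟩
  · funext k
    by_cases hk : k = (f.symm F).1
    · subst hk; exact huv
    · exact (h1 u k hk).trans (h1 v k hk).symm
  · have h2 : c.aut.symm (Pi.mulSingle (f.symm F).1 u) • y = y := by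
      rw [hst]
      intro k hk
      rw [c.aut.apply_symm_apply, Pi.mulSingle_eq_of_ne hk]
    obtain ⟨v, hv⟩ := (hrange y hy _).1 h2
    refine ⟨v, ?_⟩
    change c.aut (π.facetHom F.1 v) _ = u
    rw [show π.facetHom F.1 v = _ from hv, c.aut.apply_symm_apply, Pi.mulSingle_eq_same]

/-- The circle of a facet fixes the points over this facet. -/
theorem facetHom_smul {x : M} {F : Facet P} (hF : F ∈ facetsAt P (π.toFun x : E)) (u : Circle) :
    π.facetHom F u • x = x := by
  obtain ⟨c, hx⟩ := π.exists_chart x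
  obtain ⟨f, hf⟩ := π.exists_coordinate c hx
  rw [c.smul_eq_self_iff _ hx]
  intro i hi
  refine (hf ⟨F, hF⟩).1 u i ?_
  rintro rfl
  exact hi (f ⟨F, hF⟩).2

variable [Fintype (Facet P)]

/-- The characteristic homomorphism `T^m → T^n`. -/
def charHom : (Facet P → Circle) →* Torus n where
  toFun u := ∏ F, π.facetHom F (u F)
  map_one' := by simp
  map_mul' u v := by simp [Finset.prod_mul_distrib]

theorem continuous_charHom : Continuous (π.charHom) :=
  continuous_finsetProd _ fun F _ => (π.continuous_facetHom F).comp (continuous_apply F)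

theorem aut_charHom (c : StandardChart n M) (u : Facet P → Circle) (k : Fin n) :
    c.aut (π.charHom u) k = ∏ F, c.aut (π.facetHom F (u F)) k := by
  change c.aut (∏ F, π.facetHom F (u F)) k = _
  rw [map_prod, Finset.prod_apply]

/-- The circles of the facets through the image of `x` fix `x`, so these components are invisible at
`x`. -/
theorem charHom_smul {x : M} {u v : Facet P → Circle}
    (h : ∀ F ∉ facetsAt P (π.toFun x : E), u F = v F) :
    π.charHom u • x = π.charHom v • x := by
  rw [← inv_smul_eq_iff, smul_smul, ← map_inv, ← map_mul]
  have : ∀ s : Finset (Facet P), (∏ F ∈ s, π.facetHom F ((v⁻¹ * u) F)) • x = x := by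
    intro s
    classical
    induction s using Finset.induction_on with
    | empty => simp
    | insert F s hF ih =>
      rw [Finset.prod_insert hF, mul_smul, ih]
      by_cases hFx : F ∈ facetsAt P (π.toFun x : E)
      · exact π.facetHom_smul hFx _
      · simp [h F hFx]
  exact this Finset.univ

/-- The stabilizer of a point is generated by the circles of the facets through its image. -/
theorem exists_charHom_eq {x : M} {g : Torus n} (hg : g • x = x) :
    ∃ u : Facet P → Circle, (∀ F ∉ facetsAt P (π.toFun x : E), u F = 1) ∧
      π.charHom u = g := by
  classical
  obtain ⟨c, hx⟩ := π.exists_chart x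
  obtain ⟨f, hf⟩ := π.exists_coordinate c hx
  -- Each facet through the image of `x` governs exactly one vanishing coordinate, so the equation
  -- is solved coordinate by coordinate.
  choose u hu using fun F => (hf F).2.2 (c.aut g (f F))
  let v : Facet P → Circle := fun F => if h : F ∈ facetsAt P (π.toFun x : E) then u ⟨F, h⟩ else 1
  refine ⟨v, fun F hF => by simp [v, hF], c.aut.injective ?_⟩
  funext k
  rw [aut_charHom]
  by_cases hk : k ∈ c.zeros x
  · rw [Finset.prod_eq_single (f.symm ⟨k, hk⟩).1]
    · have h1 := hu (f.symm ⟨k, hk⟩)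
      simp only [f.apply_symm_apply] at h1
      simpa [v] using h1
    · intro F _ hF
      by_cases h : F ∈ facetsAt P (π.toFun x : E)
      · refine (hf ⟨F, h⟩).1 _ k ?_
        rintro rfl
        exact hF (by simp)
      · simp [v, h]
    · simp
  · rw [((c.smul_eq_self_iff g hx).1 hg) k hk]
    refine Finset.prod_eq_one fun F _ => ?_
    by_cases h : F ∈ facetsAt P (π.toFun x : E)
    · refine (hf ⟨F, h⟩).1 _ k ?_
      rintro rfl
      exact hk (f ⟨F, h⟩).2
    · simp [v, h]

/-- The characteristic homomorphism is injective on the torus of the facets through a point. -/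
theorem eq_one_of_charHom_eq_one (p : P) {u : Facet P → Circle}
    (hu : ∀ F ∉ facetsAt P (p : E), u F = 1) (h : π.charHom u = 1) : u = 1 := by
  obtain ⟨x, rfl⟩ := π.isQuotientMap.surjective p
  obtain ⟨c, hx⟩ := π.exists_chart x
  obtain ⟨f, hf⟩ := π.exists_coordinate c hx
  funext F
  by_cases hF : F ∈ facetsAt P (π.toFun x : E)
  · refine (hf ⟨F, hF⟩).2.1 ?_
    have h1 := π.aut_charHom c u (f ⟨F, hF⟩)
    rw [h, Finset.prod_eq_single F] at h1
    · simpa using h1.symm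
    · intro G _ hG
      by_cases hGx : G ∈ facetsAt P (π.toFun x : E)
      · refine (hf ⟨G, hGx⟩).1 _ _ fun h2 => hG ?_
        have := f.injective (Subtype.ext h2)
        exact (congrArg Subtype.val this).symm
      · simp [hu G hGx]
    · simp
  · exact hu F hF

end OrbitMap

/-- Every set of facets with a common point is the set of all facets through some point. -/
theorem OrbitMap.exists_facetsAt_eq (π : OrbitMap n M P) [Finite (Facet P)] (p : P)
    {s : Set (Facet P)} (hs : s ⊆ facetsAt P (p : E)) : ∃ q : P, facetsAt P (q : E) = s := by
  obtain ⟨x, rfl⟩ := π.isQuotientMap.surjective p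
  obtain ⟨c, hx⟩ := π.exists_chart x
  obtain ⟨f, hf⟩ := π.exists_coordinate c hx
  let J : Set (Fin n) := (fun F : s => (f ⟨F.1, hs F.2⟩).1) '' univ
  have hJ : J ⊆ c.zeros x := by
    rintro _ ⟨F, -, rfl⟩
    exact (f _).2
  obtain ⟨y, hyW, hys, hyz⟩ := c.exists_near_zeros_eq hx hJ (π.eventually_facetsAt_subset x)
  refine ⟨π.toFun y, eq_of_subset_of_ncard_le (fun F hF => ?_) ?_⟩
  -- The circle of a further facet through the new point would fix `y` and yet multiply one of its
  -- nonzero coordinates by -1.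
  · by_contra hFs
    have hFx := hyW hF
    obtain ⟨u, hu⟩ := (hf ⟨F, hFx⟩).2.2 (-1)
    have h1 := (c.smul_eq_self_iff _ hys).1 (π.facetHom_smul hF u) (f ⟨F, hFx⟩).1 (by
      rw [hyz]
      rintro ⟨G, -, hG⟩
      have h2 := congrArg Subtype.val (f.injective (Subtype.ext hG))
      simp only at h2
      exact hFs (h2 ▸ G.2))
    simp only at hu
    rw [h1] at hu
    have h4 := congrArg (fun z : Circle => (z : ℂ)) hu
    norm_num at h4
  · rw [← π.ncard_zeros y c hys, hyz, ncard_image_of_injective]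
    · rw [ncard_univ]; rfl
    · intro F G hFG
      have h2 := congrArg Subtype.val (f.injective (Subtype.ext hFG))
      exact Subtype.ext h2

/-! ### A section of the orbit map -/

section Lifts

/-- A continuous real function on the trace of a convex set near a point converges if its
exponential does. -/
theorem exists_tendsto_of_exp {E : Type*} [NormedAddCommGroup E] [NormedSpace ℝ E] {P : Set E}
    {S : Set P} (hS : ∀ (p : P) (r : ℝ), IsPreconnected (Metric.ball p r ∩ S)) {p : P} {N : Set P}
    (hN : N ∈ 𝓝 p) {f : P → ℝ} (hf : ContinuousOn f (N ∩ S)) {ζ : Circle}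
    (h : Tendsto (fun q => Circle.exp (f q)) (𝓝[S] p) (𝓝 ζ)) :
    ∃ l, Tendsto f (𝓝[S] p) (𝓝 l) := by
  obtain ⟨θ, rfl⟩ := Circle.exp_surjective ζ
  have h1 : Tendsto (fun q => (Circle.exp (f q - θ) : ℂ)) (𝓝[S] p) (𝓝 1) := by
    have := (isInducing_circle_coe.continuous.tendsto _).comp (h.div_const' (Circle.exp θ))
    simpa [Function.comp_def, ← Circle.exp_sub] using this
  have h2 : Tendsto (fun q => (Circle.exp (f q - θ) : ℂ).arg) (𝓝[S] p) (𝓝 0) := by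
    have := (Complex.continuousAt_arg (x := 1) (by simp)).tendsto.comp h1
    rwa [Complex.arg_one] at this
  have h3 : ∀ᶠ q in 𝓝[S] p, (Circle.exp (f q - θ) : ℂ) ∈ Complex.slitPlane :=
    h1.eventually (Complex.isOpen_slitPlane.mem_nhds (by simp))
  obtain ⟨r, hr, hrN⟩ := Metric.mem_nhds_iff.1 (inter_mem hN (mem_nhdsWithin_iff_eventually.1 h3))
  have hW : Metric.ball p r ∩ S ∈ 𝓝[S] p :=
    inter_mem (mem_nhdsWithin_of_mem_nhds (Metric.ball_mem_nhds p hr)) self_mem_nhdsWithin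
  have hmem : ∀ q ∈ Metric.ball p r ∩ S, q ∈ N ∩ S ∧
      (Circle.exp (f q - θ) : ℂ) ∈ Complex.slitPlane :=
    fun q hq => ⟨⟨(hrN hq.1).1, hq.2⟩, (hrN hq.1).2 hq.2⟩
  obtain hemp | ⟨q₀, hq₀⟩ := (Metric.ball p r ∩ S).eq_empty_or_nonempty
  · rw [hemp, empty_mem_iff_bot] at hW
    exact ⟨0, by rw [hW]; exact tendsto_bot⟩
  have : PreconnectedSpace (Metric.ball p r ∩ S : Set P) :=
    isPreconnected_iff_preconnectedSpace.1 (hS p r)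
  have hfc : Continuous fun q : (Metric.ball p r ∩ S : Set P) => f q :=
    hf.comp_continuous continuous_subtype_val fun q => (hmem q q.2).1
  have hac : Continuous fun q : (Metric.ball p r ∩ S : Set P) =>
      (Circle.exp (f q - θ) : ℂ).arg := by
    rw [continuous_iff_continuousAt]
    intro q
    exact ContinuousAt.comp (g := Complex.arg) (Complex.continuousAt_arg (hmem q q.2).2)
      (isInducing_circle_coe.continuous.comp
        (Circle.exp.continuous.comp (hfc.sub continuous_const))).continuousAt
  -- On the connected trace, `f - θ` differs from the principal argument of its exponential by this
  -- constant, and that argument tends to 0.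
  set c := f q₀ - θ - (Circle.exp (f q₀ - θ) : ℂ).arg with hc
  have key := Circle.isCoveringMap_exp.eq_of_comp_eq
    (g₁ := fun q : (Metric.ball p r ∩ S : Set P) => f q - θ)
    (g₂ := fun q => (Circle.exp (f q - θ) : ℂ).arg + c) (hfc.sub continuous_const)
    (hac.add continuous_const)
    (by
      funext q
      simp only [Function.comp_apply, hc]
      rw [Circle.exp_add, Circle.exp_arg, Circle.exp_sub (f q₀ - θ), Circle.exp_arg, div_self',
        mul_one]) ⟨q₀, hq₀⟩ (by simp [hc])
  refine ⟨0 + c + θ, ((h2.add_const c).add_const θ).congr' ?_⟩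
  filter_upwards [hW] with q hq
  have := congrFun key ⟨q, hq⟩
  simp only at this
  rw [← this]
  ring

/-- This is an intersection of two convex sets; contractibility provides logarithms of torus-valued
functions on it. -/
theorem contractibleSpace_ball_inter_interior {E : Type*} [NormedAddCommGroup E]
    [NormedSpace ℝ E] {P : Set E} (hP : Convex ℝ P) {p : P} {r : ℝ}
    (h : (Metric.ball p r ∩ {p : P | facetsAt P (p : E) = ∅}).Nonempty) :
    ContractibleSpace (Metric.ball p r ∩ {p : P | facetsAt P (p : E) = ∅} : Set P) := by
  have : (Subtype.val '' (Metric.ball p r ∩ {p : P | facetsAt P (p : E) = ∅}) : Set E) =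
      {q | q ∈ P ∧ facetsAt P q = ∅} ∩ Metric.ball (p : E) r := by
    ext q
    simp only [mem_image, mem_inter_iff, Metric.mem_ball, mem_ofPred_eq, Subtype.exists,
      exists_and_right, exists_eq_right, Subtype.dist_eq, exists_prop]
    tauto
  have hc := ((convex_facetsAt_eq hP ∅).inter (convex_ball (p : E) r)).contractibleSpace
    (this ▸ h.image _)
  rw [← this] at hc
  exact (Topology.IsEmbedding.subtypeVal.homeomorphImage _).contractibleSpace

end Lifts

namespace OrbitMap

variable {E : Type*} [NormedAddCommGroup E] [NormedSpace ℝ E] {n : ℕ} {M : Type*}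
  [TopologicalSpace M] [MulAction (Torus n) M] {P : Set E}

/-- All vanishing coordinates of a point can be perturbed away inside a chart. -/
theorem dense_interior (π : OrbitMap n M P) [Finite (Facet P)] :
    Dense {p : P | facetsAt P (p : E) = ∅} := by
  intro p
  rw [mem_closure_iff_nhds]
  intro V hV
  obtain ⟨x, rfl⟩ := π.isQuotientMap.surjective p
  obtain ⟨c, hx⟩ := π.exists_chart x
  obtain ⟨y, hy, hys, hyz⟩ := c.exists_near_zeros_eq hx (empty_subset _)
    (π.continuous.continuousAt hV)
  refine ⟨π.toFun y, hy, ?_⟩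
  have := π.ncard_zeros y c hys
  rw [hyz, ncard_empty, eq_comm, ncard_eq_zero] at this
  exact this

variable (π : OrbitMap n M P)

theorem mem_source_of_eq {c : StandardChart n M} {x y : M} (h : π.toFun x = π.toFun y)
    (hx : x ∈ c.chart.source) : y ∈ c.chart.source := by
  obtain ⟨t, rfl⟩ := (π.eq_iff x y).1 h
  exact c.smul_mem_source t x hx

theorem preimage_image_source (c : StandardChart n M) :
    π.toFun ⁻¹' (π.toFun '' c.chart.source) = c.chart.source := by
  refine Subset.antisymm ?_ (subset_preimage_image _ _)
  rintro x ⟨y, hy, hyx⟩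
  exact π.mem_source_of_eq hyx hy

theorem zeros_eq_empty {c : StandardChart n M} {x : M} (hx : x ∈ c.chart.source)
    (h : facetsAt P (π.toFun x : E) = ∅) : c.zeros x = ∅ := by
  have := π.ncard_zeros x c hx
  rwa [h, ncard_empty, ncard_eq_zero] at this

/-- The orbit map is a principal bundle over the interior of the polytope. -/
theorem isTrivialNear [Finite (Facet P)] {p : P} (hp : facetsAt P (p : E) = ∅) :
    IsTrivialNear (Torus n) π.toFun p := by
  obtain ⟨x, rfl⟩ := π.isQuotientMap.surjective p
  obtain ⟨c, hx⟩ := π.exists_chart x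
  have hz : ∀ y ∈ π.toFun ⁻¹' ({q : P | facetsAt P (q : E) ⊆ ∅} ∩ π.toFun '' c.chart.source),
      y ∈ c.chart.source ∧ ∀ i, c.chart y i ≠ 0 := by
    rintro y ⟨hy, hy'⟩
    have hys : y ∈ c.chart.source := by rwa [← π.preimage_image_source c]
    have := π.zeros_eq_empty hys (subset_empty_iff.1 hy)
    exact ⟨hys, fun i hi => this.subset (show i ∈ c.zeros y from hi)⟩
  refine ⟨{q : P | facetsAt P (q : E) ⊆ ∅} ∩ π.toFun '' c.chart.source,
    (isOpen_facetsAt_subset _).inter (π.isOpenMap _ c.chart.open_source),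
    ⟨hp.subset, mem_image_of_mem _ hx⟩, fun y => c.aut.symm fun i => phase (c.chart y i), ?_, ?_⟩
  · refine c.aut.symm.continuous.comp_continuousOn (continuousOn_pi.2 fun i y hy => ?_)
    obtain ⟨hys, hyi⟩ := hz y hy
    have h1 : ContinuousAt (fun y => c.chart y i) y :=
      (continuous_apply i).continuousAt.comp (c.chart.continuousAt hys)
    exact (ContinuousAt.comp (f := fun y => c.chart y i) (g := phase)
      (continuousAt_phase (hyi i)) h1).continuousWithinAt
  · intro k y hy
    obtain ⟨hys, hyi⟩ := hz y hy
    refine c.aut.injective ?_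
    rw [map_mul, c.aut.apply_symm_apply, c.aut.apply_symm_apply]
    funext i
    rw [c.chart_smul_apply k hys, phase_mul _ (hyi i)]
    rfl

/-- A standard chart yields a local section of the orbit map. -/
theorem exists_local_section (c : StandardChart n M) :
    ∃ s : P → M, ContinuousOn s (π.toFun '' c.chart.source) ∧
      ∀ p ∈ π.toFun '' c.chart.source, π.toFun (s p) = p := by
  obtain ⟨r, hr⟩ := π.isQuotientMap.surjective.hasRightInverse
  -- Replacing coordinates by their absolute values picks one point of each orbit in the chart.
  let S : M → M := fun x => c.chart.symm fun i => (‖c.chart x i‖ : ℂ)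
  have hS : ∀ x ∈ c.chart.source, (fun i => (‖c.chart x i‖ : ℂ)) ∈ c.chart.target ∧
      π.toFun (S x) = π.toFun x := by
    intro x hx
    obtain ⟨h1, t, ht⟩ := c.exists_smul_symm (c.chart.map_source hx)
      (w := fun i => (‖c.chart x i‖ : ℂ)) (by simp)
    rw [c.chart.left_inv hx] at ht
    exact ⟨h1, ((π.eq_iff _ _).2 ⟨t, ht⟩).symm⟩
  have hSS : ∀ x ∈ c.chart.source, S (r (π.toFun x)) = S x := by
    intro x hx
    obtain ⟨t, ht⟩ := (π.eq_iff x (r (π.toFun x))).1 (hr _).symm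
    simp only [S]
    rw [← ht]
    congr 1
    funext i
    rw [c.norm_chart_smul t hx]
  refine ⟨fun p => S (r p), ?_, ?_⟩
  · rw [continuousOn_iff_continuous_domRestrict, (π.isQuotientMap.restrictPreimage_isOpen
      (π.isOpenMap _ c.chart.open_source)).continuous_iff]
    have hSc : ContinuousOn S c.chart.source := by
      refine c.chart.continuousOn_symm.comp ?_ fun x hx => (hS x hx).1
      exact continuousOn_pi.2 fun i => Complex.continuous_ofReal.comp_continuousOn
        ((continuous_apply i).comp_continuousOn c.chart.continuousOn).norm
    rw [← π.preimage_image_source c, continuousOn_iff_continuous_domRestrict] at hSc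
    exact hSc.congr fun x => (hSS x ((π.preimage_image_source c).subset x.2)).symm
  · rintro _ ⟨x, hx, rfl⟩
    simp only
    rw [hSS x hx, (hS x hx).2]

variable [ContinuousSMul (Torus n) M]

/-- The orbit map has a section over the interior of the polytope. -/
theorem exists_interior_section [Finite (Facet P)] :
    ∃ s : P → M, ContinuousOn s {p : P | facetsAt P (p : E) = ∅} ∧
      ∀ p : P, facetsAt P (p : E) = ∅ → π.toFun (s p) = p := by
  classical
  obtain ⟨r, hr⟩ := π.isQuotientMap.surjective.hasRightInverse
  by_cases hb : ∃ b : P, facetsAt P (b : E) = ∅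
  swap
  · refine ⟨r, ?_, fun p _ => hr p⟩
    intro p hp
    exact absurd ⟨p, hp⟩ hb
  obtain ⟨b, hb⟩ := hb
  have hline : ∀ q : I × {p : P | facetsAt P (p : E) = ∅},
      (1 - (q.1 : ℝ)) • (b : E) + (q.1 : ℝ) • (q.2 : E) ∈ {p | p ∈ P ∧ facetsAt P p = ∅} :=
    fun q => convex_facetsAt_eq π.convex ∅ ⟨b.2, hb⟩ ⟨q.2.1.2, q.2.2⟩
      (sub_nonneg.2 q.1.2.2) q.1.2.1 (by ring)
  -- The straight-line expansion of the interior from `b`, lifted from a constant map over `b`, ends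
  -- at a section.
  let H : C(I × {p : P | facetsAt P (p : E) = ∅}, P) :=
    ⟨fun q => ⟨(1 - (q.1 : ℝ)) • (b : E) + (q.1 : ℝ) • (q.2 : E), (hline q).1⟩, by fun_prop⟩
  obtain ⟨F, hF, -⟩ := exists_homotopy_lift π.isQuotientMap π.eq_iff
    (ContinuousMulEquiv.refl (Fin n → Circle)) H (fun q => π.isTrivialNear (hline q).2)
    (ContinuousMap.const _ (r b)) (fun a => by
      rw [ContinuousMap.const_apply, hr]
      apply Subtype.ext
      simp [H])
  refine ⟨fun p => if h : facetsAt P (p : E) = ∅ then F (1, ⟨p, h⟩) else r p, ?_, fun p hp => ?_⟩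
  · rw [continuousOn_iff_continuous_domRestrict]
    have : Continuous fun p : {p : P | facetsAt P (p : E) = ∅} => F (1, p) := by fun_prop
    refine this.congr fun p => ?_
    have hp : facetsAt P ((p : P) : E) = ∅ := p.2
    simp [hp]
  · simp only
    rw [dif_pos hp, hF]
    apply Subtype.ext
    simp [H]

/-- On interior points near `p` the chart section is `s p = exp(v p) • s₀`, with `s₀` a section over
the interior. Averaging the logarithms `v p` gives an interior section `f` which, unlike `s₀` in
general, extends to the boundary. In a chart at `p`, coordinates that vanish at `p` tend to 0
whatever their phase; in the others the relevant components of the differences `v γ - v p` converge.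
-/
theorem exists_section [Finite (Facet P)] [CompactSpace M] [T2Space M] :
    ∃ s : P → M, Continuous s ∧ ∀ p, π.toFun (s p) = p := by
  classical
  have hPc : CompactSpace P := ⟨by
    rw [← π.isQuotientMap.surjective.range_eq]
    exact isCompact_range π.continuous⟩
  let S : Set P := {p | facetsAt P (p : E) = ∅}
  let e : Torus n ≃ₜ* (Fin n → Circle) := ContinuousMulEquiv.refl _
  obtain ⟨r, hr⟩ := π.isQuotientMap.surjective.hasRightInverse
  choose c hc using fun p => π.exists_chart (r p)
  have hcp : ∀ p, p ∈ π.toFun '' (c p).chart.source := fun p => ⟨r p, hc p, hr p⟩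
  have hUo : ∀ p, IsOpen (π.toFun '' (c p).chart.source) :=
    fun p => π.isOpenMap _ (c p).chart.open_source
  choose R hR hRsub using fun p => Metric.mem_nhds_iff.1 ((hUo p).mem_nhds (hcp p))
  choose s hs hsπ using fun p => π.exists_local_section (c p)
  obtain ⟨s₀, hs₀, hs₀π⟩ := π.exists_interior_section
  have hlift : ∀ p, ∃ v : P → Fin n → ℝ, ContinuousOn v (Metric.ball p (R p) ∩ S) ∧
      ∀ q ∈ Metric.ball p (R p) ∩ S, torusExp e (v q) • s₀ q = s p q := by
    intro p
    have hfib : ∀ q ∈ Metric.ball p (R p) ∩ S, π.toFun (s₀ q) = π.toFun (s p q) := fun q hq => by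
      rw [hs₀π q hq.2, hsπ p q (hRsub p hq.1)]
    have hg : ∀ q, ∃ k : Torus n, q ∈ Metric.ball p (R p) ∩ S → k • s₀ q = s p q := fun q => by
      by_cases hq : q ∈ Metric.ball p (R p) ∩ S
      · obtain ⟨k, hk⟩ := (π.eq_iff _ _).1 (hfib q hq)
        exact ⟨k, fun _ => hk⟩
      · exact ⟨1, fun h => absurd h hq⟩
    choose g hg using hg
    have hgc : ContinuousOn g (Metric.ball p (R p) ∩ S) := by
      rw [continuousOn_iff_continuous_domRestrict]
      refine continuous_of_smul_eq (x := fun q : (Metric.ball p (R p) ∩ S : Set P) => s₀ q)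
        (y := fun q => s p q) (q := π.toFun) ?_ ?_ π.continuous (fun q => hfib q q.2) ?_
        (fun q => hg q q.2)
      · exact hs₀.comp_continuous continuous_subtype_val fun q => q.2.2
      · exact (hs p).comp_continuous continuous_subtype_val fun q => hRsub p q.2.1
      · intro q
        rw [hs₀π q q.2.2]
        exact π.isTrivialNear q.2.2
    have := contractibleSpace_ball_inter_interior π.convex (p := p) (r := R p)
      (π.dense_interior.inter_open_nonempty _ Metric.isOpen_ball ⟨p, Metric.mem_ball_self (hR p)⟩)
    obtain ⟨v, hv, hve⟩ := exists_log_of_contractible e hgc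
    exact ⟨v, hv, fun q hq => by rw [hve q hq, hg q hq]⟩
  choose v hv hve using hlift
  obtain ⟨t, -, ht⟩ := isCompact_univ.elim_nhds_subcover (fun p => Metric.ball p (R p))
    fun p _ => Metric.ball_mem_nhds p (hR p)
  obtain ⟨ρ, hρ⟩ := PartitionOfUnity.exists_isSubordinate (ι := t) (X := P) isClosed_univ
    (fun γ => Metric.ball γ.1 (R γ)) (fun γ => Metric.isOpen_ball) (fun p hp => by
      obtain ⟨γ, hγ, hp⟩ := mem_iUnion₂.1 (ht hp)
      exact mem_iUnion.2 ⟨⟨γ, hγ⟩, hp⟩)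
  have hsum : ∀ q, ∑ γ, ρ γ q = 1 := fun q => by
    rw [← finsum_eq_sum_of_fintype]
    exact ρ.sum_eq_one (mem_univ q)
  let f : P → M := fun q => torusExp e (∑ γ, ρ γ q • v γ q) • s₀ q
  have hfπ : ∀ q ∈ S, π.toFun (f q) = q := fun q hq => by
    rw [π.toFun_smul, hs₀π q hq]
  have hlim : ∀ p, ∃ y, Tendsto f (𝓝[S] p) (𝓝 y) := by
    intro p
    have hsrc : ∀ q ∈ π.toFun '' (c p).chart.source, ∀ y, π.toFun y = q →
        y ∈ (c p).chart.source := by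
      rintro _ ⟨x, hx, rfl⟩ y hy
      exact π.mem_source_of_eq hy.symm hx
    have hU : ∀ q ∈ Metric.ball p (R p), q ∈ π.toFun '' (c p).chart.source := fun q hq => hRsub p hq
    -- The linear form `a i` records how the exponential of a vector turns coordinate `i` of the
    -- chart.
    have hchar : ∀ i, ∃ a : (Fin n → ℝ) →L[ℝ] ℝ, ∀ w,
        (c p).aut (torusExp e w) i = Circle.exp (a w) := fun i =>
      exists_linear_of_character
        ((continuous_apply i).comp ((c p).aut.continuous.comp (continuous_torusExp e)))
        fun w w' => by rw [torusExp_add, map_mul]; rfl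
    choose a ha using hchar
    have hcoord : ∀ γ, p ∈ Metric.ball γ (R γ) → ∀ i,
        ContinuousAt (fun q => (c p).chart (s γ q) i) p := by
      intro γ hγ i
      have h1 : ContinuousAt (s γ) p := (hs γ).continuousAt ((hUo γ).mem_nhds (hRsub γ hγ))
      have h2 := (c p).chart.continuousAt (hsrc p (hcp p) (s γ p) (hsπ γ p (hRsub γ hγ)))
      exact (continuous_apply i).continuousAt.comp (ContinuousAt.comp (f := s γ) h2 h1)
    have hpp : p ∈ Metric.ball p (R p) := Metric.mem_ball_self (hR p)
    have hδ : ∀ γ, ∀ q ∈ Metric.ball γ (R γ) ∩ Metric.ball p (R p) ∩ S,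
        torusExp e (v γ q - v p q) • s p q = s γ q := by
      intro γ q hq
      rw [← hve p q ⟨hq.1.2, hq.2⟩, smul_smul, ← torusExp_add, sub_add_cancel,
        hve γ q ⟨hq.1.1, hq.2⟩]
    have hball : ∀ᶠ q in 𝓝[S] p, q ∈ Metric.ball p (R p) ∩ S :=
      inter_mem (mem_nhdsWithin_of_mem_nhds (Metric.ball_mem_nhds p (hR p))) self_mem_nhdsWithin
    -- The exponential is a quotient of phases of two sections that are continuous and nonzero in
    -- this coordinate at `p`, so it converges; hence so does the logarithm.
    have hconv : ∀ i ∉ (c p).zeros (s p p), ∀ γ, p ∈ Metric.ball γ (R γ) →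
        ∃ l, Tendsto (fun q => a i (v γ q - v p q)) (𝓝[S] p) (𝓝 l) := by
      intro i hi γ hγ
      have hN : Metric.ball γ (R γ) ∩ Metric.ball p (R p) ∈ 𝓝 p :=
        inter_mem (Metric.isOpen_ball.mem_nhds hγ) (Metric.ball_mem_nhds p (hR p))
      have hi' : (c p).chart (s γ p) i ≠ 0 := by
        obtain ⟨k, hk⟩ := (π.eq_iff (s p p) (s γ p)).1
          ((hsπ p p (hcp p)).trans (hsπ γ p (hRsub γ hγ)).symm)
        rw [← hk, (c p).chart_smul_apply k (hsrc p (hcp p) _ (hsπ p p (hcp p)))]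
        exact mul_ne_zero (Circle.coe_ne_zero _) hi
      refine exists_tendsto_of_exp (N := Metric.ball γ (R γ) ∩ Metric.ball p (R p)) ?_ hN ?_
        (ζ := phase ((c p).chart (s γ p) i) * (phase ((c p).chart (s p p) i))⁻¹) ?_
      · intro b r'
        obtain h | h := (Metric.ball b r' ∩ S).eq_empty_or_nonempty
        · rw [h]
          exact isPreconnected_empty
        · have := contractibleSpace_ball_inter_interior π.convex h
          exact isPreconnected_iff_preconnectedSpace.2 inferInstance
      · refine (a i).continuous.comp_continuousOn (((hv γ).mono ?_).sub ((hv p).mono ?_))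
        · exact fun q hq => ⟨hq.1.1, hq.2⟩
        · exact fun q hq => ⟨hq.1.2, hq.2⟩
      · have h1 : ContinuousAt (fun q => phase ((c p).chart (s γ q) i) *
            (phase ((c p).chart (s p q) i))⁻¹) p :=
          (ContinuousAt.comp (f := fun q => (c p).chart (s γ q) i) (g := phase)
            (continuousAt_phase hi') (hcoord γ hγ i)).mul
          (ContinuousAt.comp (f := fun q => (c p).chart (s p q) i) (g := phase)
            (continuousAt_phase hi) (hcoord p hpp i)).inv
        refine (h1.tendsto.mono_left nhdsWithin_le_nhds).congr' ?_
        filter_upwards [self_mem_nhdsWithin, mem_nhdsWithin_of_mem_nhds hN,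
          ((hcoord p hpp i).eventually_ne hi).filter_mono nhdsWithin_le_nhds] with q hqS hqN hq0
        rw [← hδ γ q ⟨hqN, hqS⟩, (c p).chart_smul_apply _
          (hsrc q (hU q hqN.2) _ (hsπ p q (hU q hqN.2))), phase_mul _ hq0, mul_inv_cancel_right,
          ha]
    have hconv' : ∀ i ∉ (c p).zeros (s p p), ∃ l,
        Tendsto (fun q => a i (∑ γ : t, ρ γ q • (v γ q - v p q))) (𝓝[S] p) (𝓝 l) := by
      intro i hi
      have : ∀ γ : t, ∃ l, Tendsto (fun q => ρ γ q * a i (v γ q - v p q)) (𝓝[S] p) (𝓝 l) := by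
        intro γ
        by_cases hγ : p ∈ Metric.ball γ.1 (R γ)
        · obtain ⟨l, hl⟩ := hconv i hi γ hγ
          exact ⟨ρ γ p * l, (((ρ γ).continuous.tendsto p).mono_left nhdsWithin_le_nhds).mul hl⟩
        · have h0 : ρ γ =ᶠ[𝓝[S] p] 0 :=
            (notMem_tsupport_iff_eventuallyEq.1 fun h => hγ (hρ γ h)).filter_mono
              nhdsWithin_le_nhds
          refine ⟨0, tendsto_const_nhds.congr' ?_⟩
          filter_upwards [h0] with q hq
          rw [hq, Pi.zero_apply, zero_mul]
      choose l hl using this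
      refine ⟨∑ γ, l γ, ?_⟩
      simp only [map_sum, map_smul, smul_eq_mul]
      exact tendsto_finsetSum _ fun γ _ => hl γ
    -- As the weights sum to 1, `s₀` can be traded for the section `s p`, which is continuous at
    -- `p`.
    have hfs : ∀ q ∈ Metric.ball p (R p) ∩ S,
        f q = torusExp e (∑ γ : t, ρ γ q • (v γ q - v p q)) • s p q := by
      intro q hq
      rw [← hve p q hq, smul_smul, ← torusExp_add]
      simp only [f, smul_sub, Finset.sum_sub_distrib, ← Finset.sum_smul, hsum, one_smul,
        sub_add_cancel]
    have hfc : ∀ i, ∀ q ∈ Metric.ball p (R p) ∩ S, (c p).chart (f q) i =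
        Circle.exp (a i (∑ γ : t, ρ γ q • (v γ q - v p q))) * (c p).chart (s p q) i := by
      intro i q hq
      rw [hfs q hq, (c p).chart_smul_apply _ (hsrc q (hU q hq.1) _ (hsπ p q (hU q hq.1))), ha]
    -- The limit has the moduli of the chart image of `s p p`, so it stays in the chart target by
    -- invariance.
    have hw : ∀ i, ∃ w : ℂ, ‖(c p).chart (s p p) i‖ = ‖w‖ ∧
        Tendsto (fun q => (c p).chart (f q) i) (𝓝[S] p) (𝓝 w) := by
      intro i
      have h1 := (hcoord p hpp i).tendsto.mono_left (nhdsWithin_le_nhds (s := S))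
      by_cases hi : i ∈ (c p).zeros (s p p)
      · have hi' : (c p).chart (s p p) i = 0 := hi
        refine ⟨0, by rw [hi'], ?_⟩
        rw [tendsto_zero_iff_norm_tendsto_zero]
        rw [hi', tendsto_zero_iff_norm_tendsto_zero] at h1
        refine h1.congr' ?_
        filter_upwards [hball] with q hq
        rw [hfc i q hq, norm_mul, Circle.norm_coe, one_mul]
      · obtain ⟨l, hl⟩ := hconv' i hi
        refine ⟨Circle.exp l * (c p).chart (s p p) i, by simp, ?_⟩
        refine Tendsto.congr' ?_ (((isInducing_circle_coe.continuous.tendsto _).comp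
          ((Circle.exp.continuous.tendsto l).comp hl)).mul h1)
        filter_upwards [hball] with q hq
        exact (hfc i q hq).symm
    choose w hwn hwt using hw
    have hpsrc := hsrc p (hcp p) _ (hsπ p p (hcp p))
    obtain ⟨hwT, -⟩ := (c p).exists_smul_symm ((c p).chart.map_source hpsrc) hwn
    refine ⟨(c p).chart.symm w, Tendsto.congr' ?_
      (((c p).chart.continuousAt_symm hwT).tendsto.comp (tendsto_pi_nhds.2 hwt))⟩
    filter_upwards [hball] with q hq
    exact (c p).chart.left_inv (hsrc q (hU q hq.1) _ (hfπ q hq.2))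
  have hd : IsDenseInducing (Subtype.val : S → P) := ⟨.subtypeVal, by
    rw [DenseRange, Subtype.range_coe]
    exact π.dense_interior⟩
  have hlim' : ∀ p, ∃ y, Tendsto (fun q : S => f q) (comap Subtype.val (𝓝 p)) (𝓝 y) := fun p => by
    obtain ⟨y, hy⟩ := hlim p
    exact ⟨y, hy.comp (tendsto_nhdsWithin_iff.2 ⟨tendsto_comap,
      Eventually.of_forall fun q => q.2⟩)⟩
  refine ⟨hd.extend fun q => f q, hd.continuous_extend hlim', fun p => ?_⟩
  obtain ⟨y, hy⟩ := hlim' p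
  rw [hd.extend_eq_of_tendsto hy]
  have := hd.comap_nhds_neBot p
  refine tendsto_nhds_unique ((π.continuous.tendsto y).comp hy) ?_
  refine Tendsto.congr (fun q => (hfπ q q.2).symm) tendsto_comap

end OrbitMap

/-! ### The moment-angle manifold of a polytope -/

section MomentAngle

variable {E : Type*} [NormedAddCommGroup E] [NormedSpace ℝ E]

/-- The moment-angle manifold of a polytope `P`: the points of `P` together with complex numbers
whose absolute values are the slacks of the facets. -/
def momentAngleManifold (P : Set E) : Set (P × (Facet P → ℂ)) :=
  {y | ∀ F, ‖y.2 F‖ = slack F (y.1 : E)}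

variable {P : Set E}

theorem momentAngleManifold_eq_zero_iff (y : momentAngleManifold P) (F : Facet P) :
    y.1.2 F = 0 ↔ F ∈ facetsAt P (y.1.1 : E) := by
  rw [← norm_eq_zero, y.2 F, slack_eq_zero F y.1.1.2]

instance : MulAction (Facet P → Circle) (momentAngleManifold P) where
  smul t y := ⟨(y.1.1, fun F => t F * y.1.2 F), fun F => by
    rw [norm_mul, Circle.norm_coe, one_mul, y.2 F]⟩
  one_smul y := Subtype.ext (Prod.ext rfl (funext fun F => one_mul _))
  mul_smul t u y := Subtype.ext (Prod.ext rfl (funext fun F => mul_assoc _ _ _))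

instance : ContinuousSMul (Facet P → Circle) (momentAngleManifold P) where
  continuous_smul := by
    refine Continuous.subtype_mk (Continuous.prodMk (by fun_prop) (continuous_pi fun F => ?_)) _
    exact (isInducing_circle_coe.continuous.comp (by fun_prop)).mul (by fun_prop)

/-- Polar coordinates on the moment-angle manifold. -/
def polar (a : P × (Facet P → Circle)) : momentAngleManifold P :=
  ⟨(a.1, fun F => slack F (a.1 : E) * a.2 F), fun F => by
    rw [norm_mul, Circle.norm_coe, mul_one, Complex.norm_real, Real.norm_eq_abs,
      abs_of_nonneg (slack_nonneg F a.1.2)]⟩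

theorem polar_phase (y : momentAngleManifold P) :
    polar (y.1.1, fun F => phase (y.1.2 F)) = y := by
  refine Subtype.ext (Prod.ext rfl (funext fun F => ?_))
  change (slack F (y.1.1 : E) : ℂ) * phase (y.1.2 F) = _
  rw [← y.2 F, norm_mul_phase]

theorem surjective_polar : Function.Surjective (polar (P := P)) := fun y => ⟨_, polar_phase y⟩

theorem continuous_polar : Continuous (polar (P := P)) := by
  refine Continuous.subtype_mk (Continuous.prodMk (by fun_prop) (continuous_pi fun F => ?_)) _
  exact (Complex.continuous_ofReal.comp ((continuous_slack F).comp (by fun_prop))).mul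
    (isInducing_circle_coe.continuous.comp (by fun_prop))

instance [CompactSpace P] : CompactSpace (momentAngleManifold P) :=
  surjective_polar.compactSpace continuous_polar

/-- Continuity of a map out of the moment-angle manifold can thus be tested on `P` times the torus,
where no phase is undefined. -/
theorem isQuotientMap_polar [CompactSpace P] : Topology.IsQuotientMap (polar (P := P)) :=
  .of_surjective_continuous surjective_polar continuous_polar

end MomentAngle

/-! ### The principal bundle from the moment-angle manifold to `M` -/

namespace OrbitMap

variable {E : Type*} [NormedAddCommGroup E] [NormedSpace ℝ E] {n : ℕ} {M : Type*}
  [TopologicalSpace M] [MulAction (Torus n) M] {P : Set E} (π : OrbitMap n M P)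
  [Finite (Facet P)] [Fintype (Facet P)]

/-- Over a vertex, the characteristic homomorphism is onto. -/
theorem exists_charHom_eq_of_vertex {v : P} (hv : (facetsAt P (v : E)).ncard = n) (g : Torus n) :
    ∃ u : Facet P → Circle, (∀ F ∉ facetsAt P (v : E), u F = 1) ∧ π.charHom u = g := by
  obtain ⟨x, rfl⟩ := π.isQuotientMap.surjective v
  obtain ⟨c, hx⟩ := π.exists_chart x
  refine π.exists_charHom_eq ?_
  rw [c.smul_eq_self_iff g hx]
  have h1 := π.ncard_zeros x c hx
  rw [hv] at h1
  have h2 : c.zeros x = univ := eq_of_subset_of_ncard_le (subset_univ _) (by simp [h1, ncard_univ])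
  intro i hi
  exact absurd (h2 ▸ mem_univ i) hi

/-- The kernel of the characteristic homomorphism is a torus, with coordinates the facets not
through a given vertex. -/
theorem exists_kerEquiv {v : P} (hv : (facetsAt P (v : E)).ncard = n) :
    ∃ e : π.charHom.ker ≃ₜ* ({F // F ∉ facetsAt P (v : E)} → Circle),
      ∀ k F, e k F = (k : Facet P → Circle) F := by
  classical
  let ρ : π.charHom.ker →* ({F // F ∉ facetsAt P (v : E)} → Circle) :=
    { toFun := fun k F => (k : Facet P → Circle) F
      map_one' := rfl
      map_mul' := fun _ _ => rfl }
  have hρc : Continuous ρ := by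
    exact continuous_pi fun F => (continuous_apply F.1).comp continuous_subtype_val
  have hinj : Function.Injective ρ := by
    rw [injective_iff_map_eq_one]
    intro k hk
    refine Subtype.ext (π.eq_one_of_charHom_eq_one v (fun F hF => ?_) k.2)
    exact congrFun hk ⟨F, hF⟩
  have hsurj : Function.Surjective ρ := by
    intro u
    let w : Facet P → Circle := fun F => if h : F ∉ facetsAt P (v : E) then u ⟨F, h⟩ else 1
    -- Correct `w` into the kernel using only the facets through `v`, leaving the prescribed
    -- coordinates untouched.
    obtain ⟨u', hu', he⟩ := π.exists_charHom_eq_of_vertex hv (π.charHom w)⁻¹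
    refine ⟨⟨w * u', ?_⟩, ?_⟩
    · rw [MonoidHom.mem_ker, map_mul, he, mul_inv_cancel]
    · funext F
      change w F * u' F = u F
      rw [hu' F F.2, mul_one]
      simp only [w]
      rw [dif_pos F.2]
  have : CompactSpace π.charHom.ker := by
    refine isCompact_iff_compactSpace.1 (IsClosed.isCompact ?_)
    exact isClosed_singleton.preimage π.continuous_charHom
  let e := MulEquiv.ofBijective ρ ⟨hinj, hsurj⟩
  have he : Continuous e := hρc
  exact ⟨{ e with
    continuous_toFun := he
    continuous_invFun := he.continuous_symm_of_equiv_compact_to_t2 (f := e.toEquiv) },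
    fun _ _ => rfl⟩

/-- The map from the moment-angle manifold to `M` defined by a section of the orbit map. -/
def collapse (s : P → M) (y : momentAngleManifold P) : M :=
  π.charHom (fun F => phase (y.1.2 F)) • s y.1.1

variable {s : P → M}

theorem charHom_smul_section (hs : ∀ p, π.toFun (s p) = p) {p : P} {u v : Facet P → Circle}
    (h : ∀ F ∉ facetsAt P (p : E), u F = v F) : π.charHom u • s p = π.charHom v • s p :=
  π.charHom_smul (by rwa [hs])

/-- The two sides can use different phases only at vanishing coordinates, that is, for facets
through the point, whose circles fix `s a.1`. -/
theorem collapse_polar (hs : ∀ p, π.toFun (s p) = p) (a : P × (Facet P → Circle)) :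
    π.collapse s (polar a) = π.charHom a.2 • s a.1 := by
  refine π.charHom_smul_section hs fun F hF => ?_
  exact phase_eq_of_mul ((slack_pos F a.1.2).2 hF) rfl

theorem collapse_smul (hs : ∀ p, π.toFun (s p) = p) (t : Facet P → Circle)
    (y : momentAngleManifold P) : π.collapse s (t • y) = π.charHom t • π.collapse s y := by
  rw [collapse, collapse, smul_smul, ← map_mul]
  refine π.charHom_smul_section hs fun F hF => ?_
  exact phase_mul _ ((momentAngleManifold_eq_zero_iff y F).not.2 hF)

theorem toFun_collapse (hs : ∀ p, π.toFun (s p) = p) (y : momentAngleManifold P) :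
    π.toFun (π.collapse s y) = y.1.1 := by
  rw [collapse, π.toFun_smul, hs]

/-- Two points of a fibre lie over the same `p`, and `charHom` sends their phase difference into the
stabilizer of `s p`. That stabilizer comes from facets where both points have coordinate 0, so the
difference can be corrected into the kernel. -/
theorem collapse_eq_iff (hs : ∀ p, π.toFun (s p) = p) (y y' : momentAngleManifold P) :
    π.collapse s y = π.collapse s y' ↔ ∃ k : π.charHom.ker, k • y = y' := by
  constructor
  · intro h
    have hp : y.1.1 = y'.1.1 := by rw [← π.toFun_collapse hs, h, π.toFun_collapse hs]
    have h' := h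
    rw [collapse, collapse, ← hp, ← inv_smul_eq_iff, smul_smul] at h'
    obtain ⟨u, hu, hue⟩ := π.exists_charHom_eq h'
    rw [hs] at hu
    refine ⟨⟨(fun F => phase (y.1.2 F))⁻¹ * (fun F => phase (y'.1.2 F)) * u, ?_⟩, ?_⟩
    · rw [MonoidHom.mem_ker, map_mul, hue, map_mul, map_inv]
      group
    · refine Subtype.ext (Prod.ext hp (funext fun F => ?_))
      change ((phase (y.1.2 F))⁻¹ * phase (y'.1.2 F) * u F : Circle) * y.1.2 F = y'.1.2 F
      have hn : ‖y.1.2 F‖ = ‖y'.1.2 F‖ := by rw [y.2 F, y'.2 F, hp]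
      by_cases hF : F ∈ facetsAt P (y.1.1 : E)
      · rw [(momentAngleManifold_eq_zero_iff y F).2 hF, mul_zero, eq_comm,
          momentAngleManifold_eq_zero_iff, ← hp]
        exact hF
      · rw [hu F hF, mul_one]
        nth_rewrite 2 [← norm_mul_phase (y.1.2 F)]
        rw [mul_left_comm, ← Circle.coe_mul, mul_right_comm, inv_mul_cancel, one_mul, hn,
          norm_mul_phase]
  · rintro ⟨k, rfl⟩
    change _ = π.collapse s ((k : Facet P → Circle) • y)
    rw [π.collapse_smul hs, show π.charHom k = 1 from k.2, one_smul]

theorem surjective_collapse (hs : ∀ p, π.toFun (s p) = p) (hP : IsSimplePolytope n P) :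
    Function.Surjective (π.collapse s) := by
  intro x
  obtain ⟨g, hg⟩ := (π.eq_iff (s (π.toFun x)) x).1 (hs _)
  obtain ⟨v, hvP, -, hv⟩ := hP.exists_vertex (π.toFun x).2
  obtain ⟨u, -, hu⟩ := π.exists_charHom_eq_of_vertex (v := ⟨v, hvP⟩) hv g
  exact ⟨polar (π.toFun x, u), by rw [π.collapse_polar hs, hu, hg]⟩

/-- The map from the moment-angle manifold to `M` is a principal bundle. -/
theorem isTrivialNear_collapse (hs : ∀ p, π.toFun (s p) = p) (hP : IsSimplePolytope n P) (x : M) :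
    IsTrivialNear π.charHom.ker (π.collapse s) x := by
  obtain ⟨v, hvP, hsub, hv⟩ := hP.exists_vertex (π.toFun x).2
  obtain ⟨e, he⟩ := π.exists_kerEquiv (v := ⟨v, hvP⟩) hv
  -- Over this neighbourhood the coordinates of the facets missing `v` do not vanish; their phases
  -- are the coordinates of the kernel.
  have hU : ∀ y : momentAngleManifold P, facetsAt P (π.toFun (π.collapse s y) : E) ⊆ facetsAt P v →
      ∀ F : {F // F ∉ facetsAt P v}, y.1.2 F ≠ 0 := by
    intro y hy F hF
    rw [momentAngleManifold_eq_zero_iff, ← π.toFun_collapse hs] at hF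
    exact F.2 (hy hF)
  refine ⟨{x | facetsAt P (π.toFun x : E) ⊆ facetsAt P v},
    (isOpen_facetsAt_subset _).preimage π.continuous, hsub,
    fun y => e.symm fun F => phase (y.1.2 F), ?_, ?_⟩
  · refine e.symm.continuous.comp_continuousOn (continuousOn_pi.2 fun F y hy => ?_)
    have h1 : Continuous fun y : momentAngleManifold P => y.1.2 F.1 := by fun_prop
    exact (ContinuousAt.comp (f := fun y : momentAngleManifold P => y.1.2 F.1) (g := phase)
      (continuousAt_phase (hU y hy F)) h1.continuousAt).continuousWithinAt
  · intro k y hy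
    refine e.injective ?_
    rw [map_mul, e.apply_symm_apply, e.apply_symm_apply]
    funext F
    rw [Pi.mul_apply, he]
    exact phase_mul _ (hU y hy F)

variable [ContinuousSMul (Torus n) M]

theorem continuous_collapse (hs : ∀ p, π.toFun (s p) = p) (hsc : Continuous s) [CompactSpace P] :
    Continuous (π.collapse s) := by
  rw [isQuotientMap_polar.continuous_iff]
  refine Continuous.congr ?_ fun a => (π.collapse_polar hs a).symm
  exact (π.continuous_charHom.comp continuous_snd).smul (hsc.comp continuous_fst)

theorem isQuotientMap_collapse (hs : ∀ p, π.toFun (s p) = p) (hsc : Continuous s) [CompactSpace P]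
    [T2Space M] (hP : IsSimplePolytope n P) : Topology.IsQuotientMap (π.collapse s) :=
  .of_surjective_continuous (π.surjective_collapse hs hP) (π.continuous_collapse hs hsc)

end OrbitMap

/-! ### The moment-angle complex and the moment-angle manifold -/

section Compare

variable {E : Type*} [NormedAddCommGroup E] [NormedSpace ℝ E] {P : Set E}

theorem norm_ofReal_mul_circle {r : ℝ} (hr : 0 ≤ r) (t : Circle) : ‖(r : ℂ) * t‖ = r := by
  rw [norm_mul, Circle.norm_coe, mul_one, Complex.norm_real, Real.norm_eq_abs, abs_of_nonneg hr]

theorem mem_boundaryDual_iff {s : Finset (Facet P)} :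
    s ∈ boundaryDual P ↔ ∃ p : P, (s : Set (Facet P)) ⊆ facetsAt P (p : E) := by
  constructor
  · rintro ⟨p, hp, hps⟩
    exact ⟨⟨p, hp⟩, fun F hF => mem_iInter₂.1 hps F hF⟩
  · rintro ⟨p, hp⟩
    exact ⟨p, p.2, mem_iInter₂.2 fun F hF => hp hF⟩

theorem boundaryDual_mono {s t : Finset (Facet P)} (ht : t ∈ boundaryDual P) (h : s ⊆ t) :
    s ∈ boundaryDual P := by
  rw [mem_boundaryDual_iff] at ht ⊢
  obtain ⟨p, hp⟩ := ht
  exact ⟨p, fun F hF => hp (h hF)⟩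

theorem continuous_momentAngleComplex_coord (F : Facet P) :
    Continuous fun z : momentAngleComplex (boundaryDual P) => z.1 F :=
  (continuous_apply F).comp continuous_subtype_val

theorem continuous_momentAngleComplex_norm :
    Continuous fun (z : momentAngleComplex (boundaryDual P)) (F : Facet P) => ‖z.1 F‖ :=
  continuous_pi fun F => (continuous_momentAngleComplex_coord F).norm

/-- Facets are nonempty, so each coordinate circle of the standard torus bounds a disc in the
moment-angle complex. -/
theorem singleton_mem_boundaryDual (F : Facet P) : {F} ∈ boundaryDual P := by
  obtain ⟨p, hp⟩ := F.2.1
  exact mem_boundaryDual_iff.2 ⟨⟨p, F.subset hp⟩, by simpa [facetsAt] using hp⟩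

theorem mem_momentAngleComplex_iff {z : Facet P → ℂ} :
    z ∈ momentAngleComplex (boundaryDual P) ↔
      ∃ s ∈ boundaryDual P, (∀ F, ‖z F‖ ≤ 1) ∧ ∀ F ∉ s, ‖z F‖ = 1 := by
  simp only [momentAngleComplex, mem_iUnion, mem_ofPred_eq, mem_closedBall_zero_iff,
    mem_sphere_zero_iff_norm, exists_prop]
  refine exists_congr fun s => and_congr_right fun _ => ⟨fun h => ⟨fun F => ?_, h.2⟩,
    fun h => ⟨fun F _ => h.1 F, h.2⟩⟩
  by_cases hF : F ∈ s
  · exact h.1 F hF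
  · exact (h.2 F hF).le

/-- The data needed to compare the polytope with the cubical complex of its dual: a point in the
relative interior of each face, and a lower bound for slacks of facets away from a face. -/
structure FacePoints (P : Set E) where
  /-- A point in the relative interior of each face. -/
  pt : Finset (Facet P) → P
  /-- A bound separating the faces. -/
  eps : ℝ
  facetsAt_pt : ∀ s ∈ boundaryDual P, facetsAt P (pt s : E) = s
  eps_pos : 0 < eps
  eps_le : ∀ s ∈ boundaryDual P, ∀ F ∉ s, eps ≤ slack F (pt s : E)
  exists_eps_le : ∀ s ∉ boundaryDual P, ∀ p ∈ P, ∃ F ∈ s, eps ≤ slack F p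

/-- Finitely many conditions, each valid for all small positive bounds. For a set of facets that is
not a simplex, the sum of the slacks has a positive minimum on the compact set `P`. -/
theorem nonempty_facePoints [Fintype (Facet P)] (hP : IsCompact P) (p₀ : P)
    (h : ∀ (p : P) (s : Set (Facet P)), s ⊆ facetsAt P (p : E) →
      ∃ q : P, facetsAt P (q : E) = s) : Nonempty (FacePoints P) := by
  classical
  have hpt : ∀ s : Finset (Facet P), ∃ q : P, s ∈ boundaryDual P → facetsAt P (q : E) = s := by
    intro s
    by_cases hs : s ∈ boundaryDual P
    · obtain ⟨p, hp⟩ := mem_boundaryDual_iff.1 hs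
      obtain ⟨q, hq⟩ := h p s hp
      exact ⟨q, fun _ => hq⟩
    · exact ⟨p₀, fun h => absurd h hs⟩
  choose pt hpt using hpt
  have h1 : ∀ s : Finset (Facet P), ∀ F : Facet P, ∀ᶠ r in 𝓝[>] (0 : ℝ),
      s ∈ boundaryDual P → F ∉ s → r ≤ slack F (pt s : E) := by
    intro s F
    by_cases hs : s ∈ boundaryDual P ∧ F ∉ s
    · have : 0 < slack F (pt s : E) := by
        rw [slack_pos F (pt s).2, hpt s hs.1]
        exact hs.2
      filter_upwards [Ioo_mem_nhdsGT this] with r hr _ _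
      exact hr.2.le
    · exact Eventually.of_forall fun r h1 h2 => absurd ⟨h1, h2⟩ hs
  have h2 : ∀ s : Finset (Facet P), ∀ᶠ r in 𝓝[>] (0 : ℝ),
      s ∉ boundaryDual P → ∀ p ∈ P, ∃ F ∈ s, r ≤ slack F p := by
    intro s
    by_cases hs : s ∈ boundaryDual P
    · exact Eventually.of_forall fun r h => absurd hs h
    · have hcont : Continuous fun p : E => ∑ F ∈ s, slack F p :=
        continuous_finsetSum _ fun F _ => continuous_slack F
      obtain ⟨q, hq, hmin⟩ := hP.exists_isMinOn ⟨p₀, p₀.2⟩ hcont.continuousOn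
      have hpos : 0 < ∑ F ∈ s, slack F q := by
        refine (Finset.sum_nonneg fun F _ => slack_nonneg F hq).lt_of_ne' fun h0 => hs ?_
        rw [Finset.sum_eq_zero_iff_of_nonneg fun F _ => slack_nonneg F hq] at h0
        exact mem_boundaryDual_iff.2 ⟨⟨q, hq⟩, fun F hF => (slack_eq_zero F hq).1 (h0 F hF)⟩
      -- The `+ 1` keeps the denominator positive without discussing an empty `s`.
      have hd : 0 < (∑ F ∈ s, slack F q) / (s.card + 1) := by positivity
      filter_upwards [Ioo_mem_nhdsGT hd] with r hr _ p hp
      by_contra! hcon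
      have e1 : ∑ F ∈ s, slack F p ≤ s.card * r := by
        rw [← nsmul_eq_mul]
        exact Finset.sum_le_card_nsmul _ _ _ fun F hF => (hcon F hF).le
      have e2 : ∑ F ∈ s, slack F q ≤ ∑ F ∈ s, slack F p := hmin hp
      have e3 := (lt_div_iff₀ (by positivity)).1 hr.2
      nlinarith [hr.1]
  obtain ⟨r, ⟨hr1, hr2⟩, hr⟩ := (((eventually_all.2 fun s => eventually_all.2 (h1 s)).and
    (eventually_all.2 h2)).and self_mem_nhdsWithin).exists
  exact ⟨⟨pt, r, hpt, hr, fun s hs F hF => hr1 s F hs hF, hr2⟩⟩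

/-! ### Truncated slacks, multilinear interpolation and the comparison maps -/

namespace FacePoints

section Truncation

variable (D : FacePoints P)

/-- The truncated slack of a facet, with values in the unit interval. -/
def trunc (F : Facet P) (p : E) : ℝ := min 1 (slack F p / D.eps)

theorem continuous_trunc (F : Facet P) : Continuous (D.trunc F) :=
  continuous_const.min ((continuous_slack F).div_const _)

theorem trunc_nonneg (F : Facet P) {p : E} (hp : p ∈ P) : 0 ≤ D.trunc F p :=
  le_min zero_le_one (div_nonneg (slack_nonneg F hp) D.eps_pos.le)

theorem trunc_le_one (F : Facet P) (p : E) : D.trunc F p ≤ 1 := min_le_left _ _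

theorem trunc_eq_one {F : Facet P} {p : E} (h : D.eps ≤ slack F p) : D.trunc F p = 1 :=
  min_eq_left ((one_le_div D.eps_pos).2 h)

theorem trunc_eq_zero {F : Facet P} {p : E} (h : slack F p = 0) : D.trunc F p = 0 := by
  rw [trunc, h, zero_div, min_eq_right zero_le_one]

theorem trunc_pos {F : Facet P} {p : E} (h : 0 < slack F p) : 0 < D.trunc F p :=
  lt_min zero_lt_one (div_pos h D.eps_pos)

theorem empty_mem_boundaryDual (D : FacePoints P) : ∅ ∈ boundaryDual P :=
  mem_boundaryDual_iff.2 ⟨D.pt ∅, by simp⟩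

end Truncation

variable [Fintype (Facet P)] (D : FacePoints P)

open scoped Classical in
/-- The weight of a face in multilinear interpolation. -/
def weight (s : Finset (Facet P)) (r : Facet P → ℝ) : ℝ :=
  (∏ F ∈ s, (1 - r F)) * ∏ F ∈ Finset.univ \ s, r F

/-- Expand the product of the factors `(1 - r F) + r F`. -/
theorem sum_weight (r : Facet P → ℝ) : ∑ s, weight s r = 1 := by
  classical
  have := Finset.prod_add (fun F => 1 - r F) r (Finset.univ : Finset (Facet P))
  simp only [sub_add_cancel, Finset.prod_const_one, Finset.powerset_univ] at this
  rw [this]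
  refine Finset.sum_congr rfl fun s _ => ?_
  rw [weight]

theorem weight_nonneg (s : Finset (Facet P)) {r : Facet P → ℝ} (h0 : ∀ F, 0 ≤ r F)
    (h1 : ∀ F, r F ≤ 1) : 0 ≤ weight s r :=
  mul_nonneg (Finset.prod_nonneg fun F _ => sub_nonneg.2 (h1 F))
    (Finset.prod_nonneg fun F _ => h0 F)

theorem weight_eq_zero_of_mem {s : Finset (Facet P)} {r : Facet P → ℝ} {F : Facet P} (hF : F ∈ s)
    (h : r F = 1) : weight s r = 0 := by
  rw [weight, Finset.prod_eq_zero hF (by rw [h, sub_self]), zero_mul]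

theorem weight_eq_zero_of_notMem {s : Finset (Facet P)} {r : Facet P → ℝ} {F : Facet P}
    (hF : F ∉ s) (h : r F = 0) : weight s r = 0 := by
  rw [weight, Finset.prod_eq_zero (i := F) (s := _ \ s) (by simp [hF]) h, mul_zero]

/-- Multilinear interpolation of the points in the faces. -/
def interp (r : Facet P → ℝ) : E := ∑ s, weight s r • (D.pt s : E)

theorem continuous_interp : Continuous D.interp := by
  unfold interp weight
  fun_prop

theorem interp_mem (hP : Convex ℝ P) {r : Facet P → ℝ} (h0 : ∀ F, 0 ≤ r F) (h1 : ∀ F, r F ≤ 1) :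
    D.interp r ∈ P :=
  hP.sum_mem (fun s _ => weight_nonneg s h0 h1) (sum_weight r) fun s _ => (D.pt s).2

theorem slack_interp (F : Facet P) (r : Facet P → ℝ) :
    slack F (D.interp r) = ∑ s, weight s r * slack F (D.pt s : E) :=
  slack_sum F _ _ (sum_weight r) _

theorem interp_one : D.interp (fun _ => 1) = D.pt ∅ := by
  have h : ∀ s : Finset (Facet P), s ≠ ∅ → weight s (fun _ => 1) = 0 := fun s hs => by
    obtain ⟨F, hF⟩ := Finset.nonempty_iff_ne_empty.2 hs
    exact weight_eq_zero_of_mem hF rfl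
  rw [interp, Finset.sum_eq_single ∅ (fun s _ hs => by rw [h s hs, zero_smul]) (by simp)]
  simp [weight]

variable {τ : Finset (Facet P)} {r : Facet P → ℝ}

/-- A set `s` stands for the vertex of the cube with coordinate 0 on `s` and 1 elsewhere. If `r` is
1 off `τ`, only subsets of `τ` have nonzero weight. -/
theorem mem_boundaryDual_of_weight (hτ : τ ∈ boundaryDual P) (hr : ∀ F ∉ τ, r F = 1)
    {s : Finset (Facet P)} (hs : weight s r ≠ 0) : s ∈ boundaryDual P := by
  refine boundaryDual_mono hτ fun F hF => ?_
  by_contra hFτ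
  exact hs (weight_eq_zero_of_mem hF (hr F hFτ))

/-- Every point entering the average with nonzero weight lies on `F`. This makes the rescaling of
phases continuous at zero coordinates. -/
theorem slack_interp_eq_zero (hτ : τ ∈ boundaryDual P) (hr : ∀ F ∉ τ, r F = 1) {F : Facet P}
    (hF : r F = 0) : slack F (D.interp r) = 0 := by
  rw [slack_interp]
  refine Finset.sum_eq_zero fun s _ => ?_
  by_cases hs : weight s r = 0
  · rw [hs, zero_mul]
  · have hFs : F ∈ s := by
      by_contra h
      exact hs (weight_eq_zero_of_notMem h hF)
    have h2 := D.facetsAt_pt s (mem_boundaryDual_of_weight hτ hr hs)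
    rw [(slack_eq_zero F (D.pt s).2).2 (by rw [h2]; exact hFs), mul_zero]

/-- An average of slacks that are all at least `D.eps`; so after interpolation the truncated slacks
off `τ` are exactly 1. -/
theorem eps_le_slack_interp (hτ : τ ∈ boundaryDual P) (hr : ∀ F ∉ τ, r F = 1) (h0 : ∀ F, 0 ≤ r F)
    (h1 : ∀ F, r F ≤ 1) {F : Facet P} (hF : F ∉ τ) : D.eps ≤ slack F (D.interp r) := by
  rw [slack_interp]
  calc D.eps = ∑ s, weight s r * D.eps := by rw [← Finset.sum_mul, sum_weight, one_mul]
    _ ≤ _ := Finset.sum_le_sum fun s _ => by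
      by_cases hs : weight s r = 0
      · rw [hs, zero_mul, zero_mul]
      · refine mul_le_mul_of_nonneg_left (D.eps_le s (mem_boundaryDual_of_weight hτ hr hs) F
          fun h => hs (weight_eq_zero_of_mem h (hr F hF))) (weight_nonneg s h0 h1)

/-- The comparison map to the moment-angle complex. -/
def toComplex : C(momentAngleManifold P, momentAngleComplex (boundaryDual P)) where
  toFun y := ⟨fun F => D.trunc F (y.1.1 : E) * phase (y.1.2 F), by
    classical
    -- The facets with slack below `D.eps` form a simplex, by the choice of `D.eps`.
    refine mem_momentAngleComplex_iff.2 ⟨Finset.univ.filter fun F => slack F (y.1.1 : E) < D.eps,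
      ?_, fun F => ?_, fun F hF => ?_⟩
    · by_contra h
      obtain ⟨F, hF, hle⟩ := D.exists_eps_le _ h _ y.1.1.2
      exact absurd (Finset.mem_filter.1 hF).2 hle.not_gt
    · rw [norm_ofReal_mul_circle (D.trunc_nonneg F y.1.1.2)]
      exact D.trunc_le_one F _
    · rw [norm_ofReal_mul_circle (D.trunc_nonneg F y.1.1.2)]
      exact D.trunc_eq_one (by simpa using hF)⟩
  continuous_toFun := by
    refine Continuous.subtype_mk (continuous_pi fun F => continuous_mul_phase (by fun_prop)
      ((D.continuous_trunc F).comp (by fun_prop)) fun y hy => D.trunc_eq_zero ?_) _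
    rw [← y.2 F, hy, norm_zero]

theorem norm_toComplex (y : momentAngleManifold P) (F : Facet P) :
    ‖(D.toComplex y).1 F‖ = D.trunc F (y.1.1 : E) :=
  norm_ofReal_mul_circle (D.trunc_nonneg F y.1.1.2) _

theorem interp_norm_mem (hP : Convex ℝ P) (z : momentAngleComplex (boundaryDual P)) :
    D.interp (fun F => ‖z.1 F‖) ∈ P := by
  obtain ⟨s, -, h, -⟩ := mem_momentAngleComplex_iff.1 z.2
  exact D.interp_mem hP (fun _ => norm_nonneg _) h

theorem slack_interp_norm_eq_zero (z : momentAngleComplex (boundaryDual P)) {F : Facet P}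
    (hF : z.1 F = 0) : slack F (D.interp fun F => ‖z.1 F‖) = 0 := by
  obtain ⟨s, hs, -, h⟩ := mem_momentAngleComplex_iff.1 z.2
  exact D.slack_interp_eq_zero hs h (by rw [hF, norm_zero])

/-- The comparison map from the moment-angle complex. -/
def ofComplex (hP : Convex ℝ P) :
    C(momentAngleComplex (boundaryDual P), momentAngleManifold P) where
  toFun z := polar (⟨D.interp fun F => ‖z.1 F‖, D.interp_norm_mem hP z⟩, fun F => phase (z.1 F))
  continuous_toFun := by
    have h : Continuous fun z : momentAngleComplex (boundaryDual P) =>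
        D.interp fun F => ‖z.1 F‖ :=
      D.continuous_interp.comp continuous_momentAngleComplex_norm
    refine Continuous.subtype_mk (Continuous.prodMk (Continuous.subtype_mk h _)
      (continuous_pi fun F => ?_)) _
    exact continuous_mul_phase (continuous_momentAngleComplex_coord F)
      ((continuous_slack F).comp h) fun z hz => D.slack_interp_norm_eq_zero z hz

/-- The base point of the moment-angle manifold. -/
def base : momentAngleManifold P := polar (D.pt ∅, 1)

/-- The standard torus in the moment-angle complex. -/
def torusMap (D : FacePoints P) : C(Facet P → Circle, momentAngleComplex (boundaryDual P)) where
  toFun t := ⟨fun F => t F, mem_momentAngleComplex_iff.2 ⟨∅, D.empty_mem_boundaryDual,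
    fun _ => (Circle.norm_coe _).le, fun _ _ => Circle.norm_coe _⟩⟩
  continuous_toFun := Continuous.subtype_mk (continuous_pi fun F =>
    isInducing_circle_coe.continuous.comp (continuous_apply F)) _

theorem toComplex_base : D.toComplex D.base = D.torusMap 1 := by
  refine Subtype.ext (funext fun F => ?_)
  have h := D.eps_le ∅ D.empty_mem_boundaryDual F (by simp)
  change (D.trunc F (D.pt ∅ : E) : ℂ) * phase (slack F (D.pt ∅ : E) * (1 : Circle)) = (1 : Circle)
  rw [D.trunc_eq_one h, phase_eq_of_mul (D.eps_pos.trans_le h) rfl]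
  simp

theorem ofComplex_torusMap (hP : Convex ℝ P) (t : Facet P → Circle) :
    D.ofComplex hP (D.torusMap t) = t • D.base := by
  have h : D.interp (fun F => ‖(D.torusMap t).1 F‖) = D.pt ∅ := by
    rw [← D.interp_one]
    congr 1
    funext F
    exact Circle.norm_coe _
  refine Subtype.ext (Prod.ext (Subtype.ext h) (funext fun F => ?_))
  change (slack F (D.interp fun F => ‖(D.torusMap t).1 F‖) : ℂ) * phase (t F) =
    t F * (slack F (D.pt ∅ : E) * (1 : Circle))
  rw [h, phase_eq_of_mul (r := 1) (t := t F) one_pos (by simp)]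
  simp [mul_comm]

/-- The comparison maps are homotopy inverse on the moment-angle manifold. -/
theorem nonempty_homotopy_manifold (hP : Convex ℝ P) : Nonempty
    (((D.ofComplex hP).comp D.toComplex).HomotopyRel (ContinuousMap.id _) {D.base}) := by
  -- The homotopy moves the point of `P` along a segment and keeps the phases of `y`; where a
  -- coordinate of `y` vanishes, the slack vanishes at both ends.
  have hmem : ∀ q : I × momentAngleManifold P, (1 - (q.1 : ℝ)) •
      D.interp (fun F => ‖(D.toComplex q.2).1 F‖) + (q.1 : ℝ) • (q.2.1.1 : E) ∈ P := fun q =>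
    hP (D.interp_norm_mem hP _) q.2.1.1.2 (sub_nonneg.2 q.1.2.2) q.1.2.1 (by ring)
  have h0 : ∀ (y : momentAngleManifold P) (F : Facet P), y.1.2 F = 0 →
      slack F (y.1.1 : E) = 0 ∧
      slack F (D.interp fun F => ‖(D.toComplex y).1 F‖) = 0 := by
    intro y F hF
    have h1 : slack F (y.1.1 : E) = 0 := by rw [← y.2 F, hF, norm_zero]
    refine ⟨h1, D.slack_interp_norm_eq_zero _ ?_⟩
    rw [← norm_eq_zero, norm_toComplex, D.trunc_eq_zero h1]
  have hc : Continuous fun q : I × momentAngleManifold P => (1 - (q.1 : ℝ)) •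
      D.interp (fun F => ‖(D.toComplex q.2).1 F‖) + (q.1 : ℝ) • (q.2.1.1 : E) := by
    have : Continuous fun q : I × momentAngleManifold P =>
        D.interp (fun F => ‖(D.toComplex q.2).1 F‖) := D.continuous_interp.comp
      (continuous_momentAngleComplex_norm.comp (D.toComplex.continuous.comp continuous_snd))
    fun_prop
  have hbase : D.interp (fun F => ‖(D.toComplex D.base).1 F‖) = D.pt ∅ := by
    rw [D.toComplex_base, ← D.interp_one]
    congr 1
    funext F
    exact Circle.norm_coe _
  refine ⟨⟨⟨⟨fun q => polar (⟨_, hmem q⟩, fun F => phase (q.2.1.2 F)), ?_⟩, ?_, ?_⟩, ?_⟩⟩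
  · refine Continuous.subtype_mk (Continuous.prodMk (Continuous.subtype_mk hc _)
      (continuous_pi fun F => ?_)) _
    refine continuous_mul_phase (by fun_prop) ((continuous_slack F).comp hc) fun q hq => ?_
    simp only [slack_lineMap]
    rw [(h0 q.2 F hq).1, (h0 q.2 F hq).2, mul_zero, mul_zero, add_zero]
  · intro y
    refine Subtype.ext (Prod.ext (Subtype.ext (by simp [ofComplex, polar])) (funext fun F => ?_))
    change (slack F _ : ℂ) * phase _ = (slack F _ : ℂ) * phase _
    simp only [Icc.coe_zero, sub_zero, one_smul, zero_smul, add_zero]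
    by_cases hF : y.1.2 F = 0
    · rw [(h0 y F hF).2]
      simp
    · have : phase ((D.toComplex y).1 F) = phase (y.1.2 F) := by
        refine phase_eq_of_mul (D.trunc_pos (p := (y.1.1 : E)) ?_) rfl
        rw [← y.2 F]
        exact norm_pos_iff.2 hF
      rw [this]
  · intro y
    refine Eq.trans ?_ (polar_phase y)
    simp only
    congr 2
    exact Subtype.ext (by simp)
  · rintro u y hy
    obtain rfl : y = D.base := hy
    refine Subtype.ext (Prod.ext (Subtype.ext ?_) (funext fun F => ?_))
    · change (1 - (u : ℝ)) • D.interp (fun F => ‖(D.toComplex D.base).1 F‖) +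
        (u : ℝ) • (D.pt ∅ : E) = D.interp (fun F => ‖(D.toComplex D.base).1 F‖)
      rw [hbase, ← add_smul, sub_add_cancel, one_smul]
    · change (slack F ((1 - (u : ℝ)) • D.interp (fun F => ‖(D.toComplex D.base).1 F‖) +
        (u : ℝ) • (D.pt ∅ : E)) : ℂ) * phase (D.base.1.2 F) =
        (slack F (D.interp (fun F => ‖(D.toComplex D.base).1 F‖)) : ℂ) *
          phase ((D.toComplex D.base).1 F)
      have hpos := D.eps_pos.trans_le (D.eps_le ∅ D.empty_mem_boundaryDual F (by simp))
      rw [hbase, ← add_smul, sub_add_cancel, one_smul, toComplex_base,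
        phase_eq_of_mul (z := D.base.1.2 F) hpos rfl]
      congr 2
      exact (phase_eq_of_mul (r := 1) one_pos (by simp [torusMap])).symm

/-- The comparison maps are homotopy inverse on the moment-angle complex. -/
theorem nonempty_homotopy_complex (hP : Convex ℝ P) : Nonempty
    ((D.toComplex.comp (D.ofComplex hP)).HomotopyRel (ContinuousMap.id _)
      {D.toComplex D.base}) := by
  -- Moduli are interpolated linearly with phases fixed; one simplex serves for the whole path.
  let g : I × momentAngleComplex (boundaryDual P) → Facet P → ℝ := fun q F =>
    (1 - (q.1 : ℝ)) * D.trunc F (D.interp fun F => ‖q.2.1 F‖) + (q.1 : ℝ) * ‖q.2.1 F‖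
  have hg0 : ∀ q F, 0 ≤ g q F := fun q F =>
    add_nonneg (mul_nonneg (sub_nonneg.2 q.1.2.2) (D.trunc_nonneg F (D.interp_norm_mem hP q.2)))
      (mul_nonneg q.1.2.1 (norm_nonneg _))
  have hgc : ∀ F, Continuous fun q => g q F := by
    intro F
    have h1 : Continuous fun q : I × momentAngleComplex (boundaryDual P) =>
        D.trunc F (D.interp fun F => ‖q.2.1 F‖) :=
      (D.continuous_trunc F).comp (D.continuous_interp.comp
        (continuous_momentAngleComplex_norm.comp continuous_snd))
    have h2 : Continuous fun q : I × momentAngleComplex (boundaryDual P) => q.2.1 F :=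
      (continuous_momentAngleComplex_coord F).comp continuous_snd
    simp only [g]
    fun_prop
  have hgz : ∀ q F, q.2.1 F = 0 → g q F = 0 := by
    intro q F hF
    simp only [g]
    rw [hF, D.trunc_eq_zero (D.slack_interp_norm_eq_zero q.2 hF), norm_zero, mul_zero, mul_zero,
      add_zero]
  have hmem : ∀ q, (fun F => (g q F : ℂ) * phase (q.2.1 F)) ∈
      momentAngleComplex (boundaryDual P) := by
    intro q
    obtain ⟨s, hs, h1, h2⟩ := mem_momentAngleComplex_iff.1 q.2.2
    have hu0 := q.1.2.1
    have hu1 := q.1.2.2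
    refine mem_momentAngleComplex_iff.2 ⟨s, hs, fun F => ?_, fun F hF => ?_⟩
    · rw [norm_ofReal_mul_circle (hg0 q F)]
      have e1 := mul_le_mul_of_nonneg_left (D.trunc_le_one F (D.interp fun F => ‖q.2.1 F‖))
        (sub_nonneg.2 hu1)
      have e2 := mul_le_mul_of_nonneg_left (h1 F) hu0
      simp only [g]
      linarith
    · rw [norm_ofReal_mul_circle (hg0 q F)]
      simp only [g]
      rw [D.trunc_eq_one (D.eps_le_slack_interp hs h2 (fun _ => norm_nonneg _) h1 hF), h2 F hF]
      ring
  have hzero : ∀ z F, (D.toComplex (D.ofComplex hP z)).1 F = g (0, z) F * phase (z.1 F) := by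
    intro z F
    change (D.trunc F (D.interp fun F => ‖z.1 F‖) : ℂ) * phase
      ((slack F (D.interp fun F => ‖z.1 F‖) : ℂ) * phase (z.1 F)) = _
    simp only [g, Icc.coe_zero, sub_zero, one_mul, zero_mul, add_zero]
    rcases (slack_nonneg F (D.interp_norm_mem hP z)).eq_or_lt with h | h
    · rw [D.trunc_eq_zero h.symm]
      simp
    · rw [phase_eq_of_mul h rfl]
  refine ⟨⟨⟨⟨fun q => ⟨_, hmem q⟩, ?_⟩, ?_, ?_⟩, ?_⟩⟩
  · exact Continuous.subtype_mk (continuous_pi fun F =>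
      continuous_mul_phase ((continuous_momentAngleComplex_coord F).comp continuous_snd) (hgc F)
        fun q hq => hgz q F hq) _
  · intro z
    exact Subtype.ext (funext fun F => (hzero z F).symm)
  · intro z
    refine Subtype.ext (funext fun F => ?_)
    simp only [g, Icc.coe_one, sub_self, zero_mul, zero_add, one_mul]
    exact norm_mul_phase _
  · rintro u z hz
    rw [mem_singleton_iff, toComplex_base] at hz
    subst hz
    refine Subtype.ext (funext fun F => ?_)
    have h1 : D.trunc F (D.interp fun F => ‖(D.torusMap 1).1 F‖) = 1 :=
      D.trunc_eq_one (D.eps_le_slack_interp D.empty_mem_boundaryDual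
        (fun _ _ => Circle.norm_coe _) (fun _ => norm_nonneg _) (fun _ => (Circle.norm_coe _).le)
        (by simp))
    have h2 : ∀ u, g (u, D.torusMap 1) F = 1 := by
      intro u
      have h3 : ‖(D.torusMap 1).1 F‖ = 1 := Circle.norm_coe _
      simp only [g]
      rw [h1, h3]
      ring
    rw [ContinuousMap.comp_apply, hzero, h2]
    change (g (u, D.torusMap 1) F : ℂ) * _ = _
    rw [h2]

/-- The standard torus in the moment-angle complex is contractible in it. -/
theorem torusMap_homotopic_const (D : FacePoints P) :
    D.torusMap.Homotopic (ContinuousMap.const _ (D.torusMap 1)) := by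
  classical
  let o : Finset (Facet P) → C(Facet P → Circle, Facet P → Circle) := fun s =>
    ⟨fun t F => if F ∈ s then t F else 1, continuous_pi fun F => by split_ifs <;> fun_prop⟩
  have key : ∀ s, (D.torusMap.comp (o s)).Homotopic (ContinuousMap.const _ (D.torusMap 1)) := by
    intro s
    induction s using Finset.induction_on with
    | empty =>
      have : D.torusMap.comp (o ∅) = ContinuousMap.const _ (D.torusMap 1) := by
        ext t
        simp [o]
        rfl
      rw [this]
    | insert F s hF ih =>
      refine ContinuousMap.Homotopic.trans (ContinuousMap.Homotopic.symm ?_) ih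
      -- Coordinate `F` alone leaves the circle, along the segment from 1 to `t F` in the disc.
      let h : I × (Facet P → Circle) → Facet P → ℂ := fun q =>
        Function.update (D.torusMap (o s q.2)).1 F (1 - (q.1 : ℝ) + (q.1 : ℝ) * (q.2 F : ℂ))
      have hc : Continuous h := by
        refine Continuous.update ?_ F ?_
        · exact continuous_subtype_val.comp (D.torusMap.continuous.comp
            ((o s).continuous.comp continuous_snd))
        · have : Continuous fun q : I × (Facet P → Circle) => ((q.2 F : Circle) : ℂ) :=
            isInducing_circle_coe.continuous.comp (by fun_prop)
          fun_prop
      have hmem : ∀ q, h q ∈ momentAngleComplex (boundaryDual P) := by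
        intro q
        refine mem_momentAngleComplex_iff.2 ⟨{F}, singleton_mem_boundaryDual F, fun G => ?_,
          fun G hG => ?_⟩
        · by_cases hG : G = F
          · subst hG
            simp only [h, Function.update_self]
            have h0 := q.1.2.1
            have h1 := q.1.2.2
            calc ‖(1 - (q.1 : ℝ) + (q.1 : ℝ) * (q.2 G : ℂ) : ℂ)‖
                ≤ ‖((1 - (q.1 : ℝ) : ℝ) : ℂ)‖ + ‖((q.1 : ℝ) : ℂ) * (q.2 G : ℂ)‖ := by
                  push_cast
                  exact norm_add_le _ _
              _ = 1 := by
                  rw [norm_ofReal_mul_circle h0, Complex.norm_real, Real.norm_eq_abs,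
                    abs_of_nonneg (sub_nonneg.2 h1)]
                  ring
          · simp only [h, Function.update_of_ne hG]
            exact (Circle.norm_coe _).le
        · simp only [h, Function.update_of_ne (Finset.notMem_singleton.1 hG)]
          exact Circle.norm_coe _
      refine ⟨⟨⟨fun q => ⟨h q, hmem q⟩, Continuous.subtype_mk hc _⟩, fun t => ?_, fun t => ?_⟩⟩
      · refine Subtype.ext (funext fun G => ?_)
        by_cases hG : G = F
        · subst hG
          simp [h, torusMap, o, hF]
        · simp [h, hG]
      · refine Subtype.ext (funext fun G => ?_)
        by_cases hG : G = F
        · subst hG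
          simp [h, torusMap, o]
        · simp [h, torusMap, o, hG]
  have h := key Finset.univ
  have h2 : D.torusMap.comp (o Finset.univ) = D.torusMap := by
    ext t
    simp [o]
  rwa [h2] at h

/-- Every point of the moment-angle complex is joined to the base point. -/
theorem joined_complex (D : FacePoints P) (z : momentAngleComplex (boundaryDual P)) :
    Joined z (D.torusMap 1) := by
  obtain ⟨s, hs, h1, h2⟩ := mem_momentAngleComplex_iff.1 z.2
  classical
  -- Disc coordinates move straight to 1; the other coordinates are already on the circle.
  let t : Facet P → Circle := fun F => if F ∈ s then 1 else phase (z.1 F)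
  have hj : Joined z (D.torusMap t) := by
    let h : I → Facet P → ℂ := fun u F => (1 - (u : ℝ)) * z.1 F + (u : ℝ) * (t F : ℂ)
    have ht : ∀ F ∉ s, z.1 F = t F := by
      intro F hF
      have := norm_mul_phase (z.1 F)
      rw [h2 F hF, Complex.ofReal_one, one_mul] at this
      simp [t, hF, this]
    have hmem : ∀ u, h u ∈ momentAngleComplex (boundaryDual P) := by
      intro u
      refine mem_momentAngleComplex_iff.2 ⟨s, hs, fun F => ?_, fun F hF => ?_⟩
      · have h0 := u.2.1
        have hu1 := u.2.2
        calc ‖(1 - (u : ℝ)) * z.1 F + (u : ℝ) * (t F : ℂ)‖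
            ≤ ‖((1 - (u : ℝ) : ℝ) : ℂ) * z.1 F‖ + ‖((u : ℝ) : ℂ) * (t F : ℂ)‖ := by
              push_cast
              exact norm_add_le _ _
          _ ≤ 1 := by
              rw [norm_ofReal_mul_circle h0, norm_mul, Complex.norm_real, Real.norm_eq_abs,
                abs_of_nonneg (sub_nonneg.2 hu1)]
              have := mul_le_mul_of_nonneg_left (h1 F) (sub_nonneg.2 hu1)
              linarith
      · have : h u F = t F := by
          simp only [h]
          rw [ht F hF]
          ring
        rw [this]
        exact Circle.norm_coe _
    refine ⟨⟨⟨fun u => ⟨h u, hmem u⟩, Continuous.subtype_mk (by fun_prop) _⟩, ?_, ?_⟩⟩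
    · refine Subtype.ext (funext fun F => ?_)
      simp [h]
    · refine Subtype.ext (funext fun F => ?_)
      simp [h, torusMap]
  obtain ⟨G⟩ := D.torusMap_homotopic_const
  refine hj.trans ⟨⟨⟨fun u => G (u, t), by fun_prop⟩, ?_, ?_⟩⟩ <;> simp

/-- Every point of the moment-angle manifold is joined to the base point. -/
theorem joined_manifold (hP : Convex ℝ P) (y : momentAngleManifold P) : Joined y D.base := by
  obtain ⟨H⟩ := D.nonempty_homotopy_manifold hP
  have h1 : Joined (D.ofComplex hP (D.toComplex y)) y := by
    refine ⟨⟨⟨fun u => H (u, y), by fun_prop⟩, ?_, ?_⟩⟩ <;> simp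
  have h2 := (D.joined_complex (D.toComplex y)).map (D.ofComplex hP).continuous
  rw [ofComplex_torusMap, one_smul] at h2
  exact h1.symm.trans h2

end FacePoints

end Compare

/-! ### Loop spaces of the base of a principal torus bundle -/

section LoopSpace

variable {κ K X B : Type*} [CommGroup K] [TopologicalSpace K] [IsTopologicalGroup K]
  [TopologicalSpace X] [MulAction K X] [ContinuousSMul K X] [TopologicalSpace B]

/-- The loop space serves as parameter space for homotopy lifting, which needs it paracompact and
Hausdorff. -/
theorem metrizableSpace_path [TopologicalSpace.MetrizableSpace B] (x y : B) :
    TopologicalSpace.MetrizableSpace (Path x y) := by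
  let _ := TopologicalSpace.metrizableSpaceMetric B
  have h : Topology.IsEmbedding ((↑) : Path x y → C(I, B)) :=
    ⟨⟨rfl⟩, fun γ γ' h => Path.ext (funext fun u => DFunLike.congr_fun h u)⟩
  exact h.metrizableSpace

/-- The loops of the base of a principal torus bundle correspond to the paths in the total space
from the base point to a point of its fibre. -/
theorem loopSpace_homotopyEquiv_pathFamily [TopologicalSpace.MetrizableSpace B] {q : X → B}
    (hq : Topology.IsQuotientMap q) (hfib : ∀ x y, q x = q y ↔ ∃ k : K, k • x = y)
    (e : K ≃ₜ* (κ → Circle)) (htriv : ∀ b, IsTrivialNear K q b) (x₀ : X) :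
    Nonempty (LoopSpace B (q x₀) ≃ₕ PathFamily (fun _ : K => x₀) fun k => k • x₀) := by
  have := metrizableSpace_path (q x₀) (q x₀)
  let _ := TopologicalSpace.metrizableSpaceMetric (LoopSpace B (q x₀))
  have hinj : ∀ {k k' : K} {x : X}, k • x = k' • x → k = k' := fun h =>
    smul_injective_of_isTrivialNear (htriv _) h
  -- Lifting the evaluation homotopy lifts all loops at once, continuously in the loop.
  obtain ⟨F, hF, hF0⟩ := exists_homotopy_lift hq hfib e
    (⟨fun p => p.2 p.1, by fun_prop⟩ : C(I × LoopSpace B (q x₀), B)) (fun _ => htriv _)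
    (ContinuousMap.const _ x₀) (fun γ => γ.source.symm)
  simp only [ContinuousMap.coe_mk, ContinuousMap.const_apply] at hF hF0
  have hF1 : ∀ γ, q x₀ = q (F (1, γ)) := fun γ => by rw [hF, γ.target]
  choose k hk using fun γ => (hfib _ _).1 (hF1 γ)
  have hkc : Continuous k := continuous_of_smul_eq continuous_const (by fun_prop) hq.continuous
    hF1 (fun _ => htriv _) hk
  let lift : C(LoopSpace B (q x₀), PathFamily (fun _ : K => x₀) fun k => k • x₀) :=
    ⟨fun γ => ⟨(k γ, ⟨fun u => F (u, γ), by fun_prop⟩), hF0 γ, (hk γ).symm⟩,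
      Continuous.subtype_mk (hkc.prodMk (ContinuousMap.continuous_of_continuous_uncurry _ (by
        change Continuous fun z : LoopSpace B (q x₀) × I => F (z.2, z.1)
        fun_prop))) _⟩
  let proj : C(PathFamily (fun _ : K => x₀) (fun k => k • x₀), LoopSpace B (q x₀)) :=
    ⟨fun p => ⟨⟨fun u => q (p.1.2 u), hq.continuous.comp (by fun_prop)⟩, congrArg q p.2.1,
      (congrArg q p.2.2).trans ((hfib _ _).2 ⟨_, rfl⟩).symm⟩, by
      refine Path.continuous_uncurry_iff.mp (hq.continuous.comp ?_)
      change Continuous fun z : PathFamily (fun _ : K => x₀) (fun k => k • x₀) × I => z.1.1.2 z.2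
      fun_prop⟩
  have hproj : ∀ z : I × PathFamily (fun _ : K => x₀) (fun k => k • x₀),
      q (F (z.1, proj z.2)) = q (z.2.1.2 z.1) := fun z => hF _
  -- `l (u, p)` carries the chosen lift of the projected path to the original path at time `u`.
  choose l hl using fun z => (hfib _ _).1 (hproj z)
  have hlc : Continuous l := continuous_of_smul_eq (F.continuous.comp (by fun_prop))
    (by fun_prop) hq.continuous hproj (fun _ => htriv _) hl
  have hl0 : ∀ p, l (0, p) = 1 := fun p => hinj (x := x₀) (by
    have := hl (0, p)
    rw [hF0] at this
    rw [this, one_smul]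
    exact p.2.1)
  -- Running `l` only to time `z.1 * u` interpolates from the chosen lift to the given path,
  -- starting at `x₀` throughout.
  refine ⟨⟨lift, proj, ?_, ⟨⟨⟨fun z => ⟨(l z * k (proj z.2),
    ⟨fun u => l (z.1 * u, z.2) • F (u, proj z.2), ?_⟩), ?_, ?_⟩, ?_⟩, ?_, ?_⟩⟩⟩⟩
  · have h : proj.comp lift = ContinuousMap.id _ := by
      ext γ u
      exact hF (u, γ)
    rw [h]
  · exact (hlc.comp (by fun_prop)).smul (by fun_prop)
  · simp only [ContinuousMap.coe_mk, mul_zero]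
    rw [hl0, one_smul, hF0]
  · simp only [ContinuousMap.coe_mk, mul_one]
    rw [mul_smul, hk]
  · refine Continuous.subtype_mk (Continuous.prodMk (by fun_prop)
      (ContinuousMap.continuous_of_continuous_uncurry _ ?_)) _
    exact (hlc.comp (by fun_prop)).smul (F.continuous.comp (by fun_prop))
  · intro p
    refine Subtype.ext (Prod.ext ?_ ?_)
    · change l (0, p) * k (proj p) = k (proj p)
      rw [hl0, one_mul]
    · ext u
      change l (0 * u, p) • F (u, proj p) = F (u, proj p)
      rw [zero_mul, hl0, one_smul]
  · intro p
    refine Subtype.ext (Prod.ext ?_ ?_)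
    · refine hinj (x := x₀) ?_
      change (l (1, p) * k (proj p)) • x₀ = p.1.1 • x₀
      rw [mul_smul, hk, hl]
      exact p.2.2
    · ext u
      change l (1 * u, p) • F (u, proj p) = p.1.2 u
      rw [one_mul, hl]

/-- If the orbit of the base point is contractible in the total space of a principal torus bundle,
then the loop space of the base splits. -/
theorem loopSpace_homotopyEquiv_prod [TopologicalSpace.MetrizableSpace B] {q : X → B}
    (hq : Topology.IsQuotientMap q) (hfib : ∀ x y, q x = q y ↔ ∃ k : K, k • x = y)
    (e : K ≃ₜ* (κ → Circle)) (htriv : ∀ b, IsTrivialNear K q b) (x₀ : X)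
    (hnull : (⟨fun k => k • x₀, by fun_prop⟩ : C(K, X)).Homotopic (ContinuousMap.const K x₀)) :
    Nonempty (LoopSpace B (q x₀) ≃ₕ K × LoopSpace X x₀) := by
  obtain ⟨e₁⟩ := loopSpace_homotopyEquiv_pathFamily hq hfib e htriv x₀
  obtain ⟨e₂⟩ := PathFamily.homotopyEquiv_of_end (s := fun _ : K => x₀) hnull
  exact ⟨e₁.trans (e₂.trans (PathFamily.prodHomeo K x₀ x₀).toHomotopyEquiv)⟩

end LoopSpace

/-! ### Assembly for quasitoric manifolds -/

section Quasitoric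

variable {E : Type*} [NormedAddCommGroup E] [NormedSpace ℝ E] {n : ℕ} {M : Type*}
  [TopologicalSpace M] [MulAction (Torus n) M] {P : Set E}

/-- Charts and compactness give second countability; a compact Hausdorff space is regular, so
Urysohn metrization applies. -/
theorem OrbitMap.metrizableSpace [CompactSpace M] [T2Space M] (π : OrbitMap n M P) :
    TopologicalSpace.MetrizableSpace M := by
  choose c hc using π.exists_chart
  let _ : ChartedSpace (Fin n → ℂ) M :=
    { atlas := range fun x => (c x).chart
      chartAt := fun x => (c x).chart
      mem_chart_source := hc
      chart_mem_atlas := fun x => ⟨x, rfl⟩ }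
  have := ChartedSpace.secondCountable_of_sigmaCompact (Fin n → ℂ) M
  exact TopologicalSpace.metrizableSpace_of_t3_secondCountable M

/-- The loop space of a quasitoric manifold is homotopy equivalent to the product of a torus and
the loop space of the moment-angle complex. -/
theorem nonempty_loopSpace_homotopyEquiv (hP : IsSimplePolytope n P)
    (hM : IsQuasitoricManifold n M P) (x : M) (z : momentAngleComplex (boundaryDual P)) :
    Nonempty (LoopSpace M x ≃ₕ
      Torus (Nat.card (Facet P) - n) × LoopSpace (momentAngleComplex (boundaryDual P)) z) := by
  have hc := hP.isConvexPolytope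
  obtain ⟨π⟩ := hM.exists_orbitMap hc
  have := hM.compactSpace
  have := hM.t2Space
  have := hM.continuousSMul
  have := hc.finite_facet
  have := isCompact_iff_compactSpace.1 hc.isCompact
  have := π.metrizableSpace
  let _ := Fintype.ofFinite (Facet P)
  obtain ⟨s, hsc, hs⟩ := π.exists_section
  obtain ⟨D⟩ := nonempty_facePoints hc.isCompact (π.toFun x) fun p _ => π.exists_facetsAt_eq p
  obtain ⟨v, hvP, -, hv⟩ := hP.exists_vertex (π.toFun x).2
  obtain ⟨e, -⟩ := π.exists_kerEquiv (v := ⟨v, hvP⟩) hv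
  -- The kernel orbit of the base point is the image under `D.ofComplex` of a subgroup of the
  -- standard torus, which contracts in the complex.
  have hnull : (⟨fun k => k • D.base, by fun_prop⟩ :
      C(π.charHom.ker, momentAngleManifold P)).Homotopic (ContinuousMap.const _ D.base) := by
    have h := (ContinuousMap.Homotopic.refl (D.ofComplex hc.convex)).comp
      (D.torusMap_homotopic_const.comp (ContinuousMap.Homotopic.refl
        (⟨fun k => k, continuous_subtype_val⟩ : C(π.charHom.ker, Facet P → Circle))))
    convert h using 1
    · ext1 k
      exact (D.ofComplex_torusMap hc.convex k).symm
    · ext1 k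
      exact ((D.ofComplex_torusMap hc.convex 1).trans (one_smul _ _)).symm
  obtain ⟨e₁⟩ := loopSpace_homotopyEquiv_prod (π.isQuotientMap_collapse hs hsc hP)
    (π.collapse_eq_iff hs) e (π.isTrivialNear_collapse hs hP) D.base hnull
  -- The moment-angle manifold is path connected, so any base point of `M` may be moved to the image
  -- of `D.base`.
  obtain ⟨y, rfl⟩ := π.surjective_collapse hs hP x
  obtain ⟨e₀⟩ := loopSpace_homotopyEquiv_of_joined
    ((D.joined_manifold hc.convex y).map (π.continuous_collapse hs hsc))
  obtain ⟨H⟩ := D.nonempty_homotopy_manifold hc.convex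
  obtain ⟨H'⟩ := D.nonempty_homotopy_complex hc.convex
  obtain ⟨e₂⟩ := loopSpace_homotopyEquiv_of_based H H'
  obtain ⟨e₃⟩ := loopSpace_homotopyEquiv_of_joined
    (((D.joined_complex z).trans (D.toComplex_base ▸ Joined.refl _)).symm :
      Joined (D.toComplex D.base) z)
  -- Exactly `n` facets pass through the vertex `v`, so the natural subtraction is not truncated.
  have hcard : Nat.card {F // F ∉ facetsAt P v} = Nat.card (Facet P) - n := by
    rw [← hv, ← Set.ncard_compl]
    rfl
  let j := Finite.equivFinOfCardEq hcard
  exact ⟨e₀.trans (e₁.trans (ContinuousMap.HomotopyEquiv.prodCongr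
    (e.toHomeomorph.trans (Homeomorph.piCongrLeft (Y := fun _ => Circle) j)).toHomotopyEquiv
    (e₂.trans e₃)))⟩

end Quasitoric

end Quasitoric

end

theorem proposition2p4
    {E : Type*} [NormedAddCommGroup E] [NormedSpace ℝ E] [FiniteDimensional ℝ E]
    (n m : ℕ) (P : Set E) (hP : Quasitoric.IsSimplePolytope n P)
    (hm : Nat.card (Quasitoric.Facet P) = m)
    {M : Type*} [TopologicalSpace M] [MulAction (Quasitoric.Torus n) M]
    (hM : Quasitoric.IsQuasitoricManifold n M P)
    (x : M) (z : Quasitoric.momentAngleComplex (Quasitoric.boundaryDual P)) :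
    Nonempty (LoopSpace M x ≃ₕ
      (Quasitoric.Torus (m - n) ×
        LoopSpace (Quasitoric.momentAngleComplex (Quasitoric.boundaryDual P)) z)) :=
  hm ▸ Quasitoric.nonempty_loopSpace_homotopyEquiv hP hM x z
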